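/- **Setting.** All alphabets $\mathcal U,\mathcal W,\mathcal X,\mathcal Y,\mathcal V$ are finite, logarithms, entropies and informations are in base 2, $\bar P_U$ is a given i.i.d. source and $\bar P_{Y|X}$ a given discrete memoryless channel. For a block length $n\ge 1$, a code of common randomness rate $R_0\ge 0$ is a pair of (possibly randomized) maps $f_n:\mathcal U^n\times\{1,\dots,\lfloor 2^{nR_0}\rfloor\}\to\mathcal X^n$ and $g_n:\mathcal Y^n\times\{1,\dots,\lfloor 2^{nR_0}\rfloor\}\to\mathcal V^n$, that is, a pair of conditional distributions of $X^n$ given $(U^n,C)$ and of $V^n$ given $(Y^n,C)$. Here $C$ is uniform and independent of $U^n\sim\bar P_U^{\otimes n}$, and $Y^n$ is the output of $\bar P_{Y|X}^{\otimes n}$ for the input $X^n$. The pair $(\bar P_{UXYV},R_0)$ is $(\varepsilon,n)$-achievable if some code of rate $R_0$ induces a distribution with $\|P_{U^nX^nY^nV^n}-\bar P_{UXYV}^{\otimes n}\|_1\le\varepsilon$, where $\|\cdot\|_1$ is the sum of absolute differences. The fixed-length strong coordination region $\mathcal R(n,\varepsilon)$ is the closure of the set of $(\varepsilon,n)$-achievable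 pairs. Let $Q(t)=\int_t^\infty \frac1{\sqrt{2\pi}}e^{-x^2/2}dx$. For a joint distribution $\bar P=\bar P_{UWXYV}$, let $V_{\bar P}$ be the dispersion of the channel $\bar P_{Y|W}$ (with inputs the $w$ such that $\bar P_W(w)>0$), namely the minimum of $\mathbb E_W[\mathrm{Var}(\imath(W;Y)\mid W)]$ over its capacity-achieving input distributions, where $\imath$ is the information density of that input distribution and the channel. Put $$c_1(\bar P)=H(U,W)+H(U),\qquad c_3(\bar P)=H(U,W,X,Y,V)+H(W).$$ Let $B(\bar P)\ge 0$ and $\kappa(\bar P,\varepsilon_1,n)\ge0$ be given coefficients and, for $\varepsilon_1>0$, $\varepsilon_5\ge0$, put $\varepsilon_4=\varepsilon_5+B(\bar P)/\sqrt n$ and $$\Delta=\kappa(\bar P,\varepsilon_1,n)\frac{\log n}{n}+Q^{-1}(\varepsilon_4)\sqrt{\frac{V_{\bar P}}{n}} .$$ Let $\mathcal R_{\rm in}(n,\varepsilon_1,\varepsilon_5)$ be the set of pairs $(\bar P_{UXYV},R_0)$ for which there is a joint distribution $\bar P_{UWXYV}$ with marginal $\bar P_{UXYV}$ such that $0<\varepsilon_4\le\frac12$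 and $$\bar P_{UWXYV}=\bar P_U\,\bar P_{W|U}\,\bar P_{X|UW}\,\bar P_{Y|X}\,\bar P_{V|WY},$$ $$I(W;U)\le I(W;Y)-c_1(\bar P)\,\varepsilon_1-\Delta,\qquad R_0\ge I(W;UXV|Y)+c_3(\bar P)\,\varepsilon_1+\Delta .$$ **Theorem (Inner bound).** Let $\bar P_U$, $\bar P_{Y|X}$, the alphabets and any function $B(\bar P)\ge0$ be given. There is $\kappa(\bar P,\varepsilon_1,n)\ge 0$ which, for fixed $\bar P$ and $\varepsilon_1>0$, is bounded in $n\ge1$ (so that $\kappa\frac{\log n}{n}=O(\frac{\log n}{n})$), which equals $\frac32$ for all $n\ge1$ and $\varepsilon_1>0$ with $n\varepsilon_1^2\ge A(\bar P)\ln n$, where $A(\bar P)>0$ depends only on $\bar P$ (once the data above are given), and is such that for all $n\ge1$, $\varepsilon_1>0$ and $\varepsilon_5\ge0$ $$\mathcal R_{\rm in}(n,\varepsilon_1,\varepsilon_5)\subseteq\mathcal R\Big(n,\;10\,\varepsilon_5+\frac{10+2\sqrt2}{\sqrt n}\Big).$$ -/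

import Mathlib

namespace StrongCoord

noncomputable section

/-! ### Information measures of finite distributions (logarithms in base 2)

A distribution on a finite type `Ω` is a function `Ω → ℝ` in `stdSimplex ℝ Ω`; a random variable is
a function on `Ω`. -/

section Information

variable {Ω α β γ : Type*} [Fintype Ω] [Fintype α] [Fintype β] [Fintype γ]

open Classical in
/-- The distribution of the random variable `A` under `p`. -/
def law (p : Ω → ℝ) (A : Ω → α) (a : α) : ℝ :=
  ∑ ω, if A ω = a then p ω else 0

/-- The entropy `H(A)`, in bits. -/
def entropy (p : Ω → ℝ) (A : Ω → α) : ℝ :=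
  ∑ a, Real.negMulLog (law p A a) / Real.log 2

/-- The conditional entropy `H(A|B)`. -/
def condEntropy (p : Ω → ℝ) (A : Ω → α) (B : Ω → β) : ℝ :=
  entropy p (fun ω => (A ω, B ω)) - entropy p B

/-- The mutual information `I(A;B)`. -/
def mutualInfo (p : Ω → ℝ) (A : Ω → α) (B : Ω → β) : ℝ :=
  entropy p A - condEntropy p A B

/-- The conditional mutual information `I(A;B|C)`. -/
def condMutualInfo (p : Ω → ℝ) (A : Ω → α) (B : Ω → β) (C : Ω → γ) : ℝ :=
  condEntropy p A C - condEntropy p A (fun ω => (B ω, C ω))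

/-- The conditional distribution `P_{B|A}(b|a)`; meaningful when `P_A(a) > 0`. -/
def condLaw (p : Ω → ℝ) (A : Ω → α) (B : Ω → β) (a : α) (b : β) : ℝ :=
  law p (fun ω => (A ω, B ω)) (a, b) / law p A a

end Information

/-! ### Channel dispersion -/

section Dispersion

variable {α β : Type*} [Fintype α] [Fintype β]

/-- The output distribution of the channel `K` for the input distribution `q`. -/
def outputLaw (K : α → β → ℝ) (q : α → ℝ) (b : β) : ℝ := ∑ a, q a * K a b

/-- The information density `log₂ (K(b|a) / (qK)(b))`. -/
def infoDensity (K : α → β → ℝ) (q : α → ℝ) (a : α) (b : β) : ℝ :=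
  Real.logb 2 (K a b / outputLaw K q b)

/-- The expectation of the information density given the input `a`. -/
def infoMean (K : α → β → ℝ) (q : α → ℝ) (a : α) : ℝ :=
  ∑ b, K a b * infoDensity K q a b

/-- The mutual information between the input and the output of `K` for the input distribution
`q`. -/
def channelInfo (K : α → β → ℝ) (q : α → ℝ) : ℝ := ∑ a, q a * infoMean K q a

/-- The conditional information variance: the average over the input `a ∼ q` of the variance, under
`K(·|a)`, of the information density. -/
def condInfoVariance (K : α → β → ℝ) (q : α → ℝ) : ℝ :=
  ∑ a, q a * ∑ b, K a b * (infoDensity K q a b - infoMean K q a) ^ 2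

/-- The input distributions of the channel `K` with input alphabet `S ⊆ α`. -/
def inputLaws (S : Set α) : Set (α → ℝ) := {q | q ∈ stdSimplex ℝ α ∧ ∀ a, a ∉ S → q a = 0}

/-- The capacity-achieving input distributions of the channel `K` with input alphabet `S ⊆ α`. -/
def capacityAchieving (K : α → β → ℝ) (S : Set α) : Set (α → ℝ) :=
  {q | q ∈ inputLaws S ∧ ∀ q' ∈ inputLaws S, channelInfo K q' ≤ channelInfo K q}

/-- The dispersion of the channel `K` with input alphabet `S ⊆ α`: the minimum of the conditional
information variance over the capacity-achieving input distributions. -/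
def dispersion (K : α → β → ℝ) (S : Set α) : ℝ :=
  sInf (condInfoVariance K '' capacityAchieving K S)

end Dispersion

/-! ### The Gaussian tail and its inverse -/

/-- The tail distribution function of the standard normal distribution. -/
def gaussianQ (t : ℝ) : ℝ :=
  ∫ x in Set.Ioi t, (1 / Real.sqrt (2 * Real.pi)) * Real.exp (-x ^ 2 / 2)

/-- The inverse of the continuous, strictly decreasing bijection `gaussianQ : ℝ → (0,1)`. -/
def gaussianQInv (p : ℝ) : ℝ := sInf {t : ℝ | gaussianQ t ≤ p}

/-! ### Codes and fixed-length strong coordination -/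

section Coordination

variable {U X Y V : Type*} [Fintype U] [Fintype X] [Fintype Y] [Fintype V]

/-- A code of block length `n` with common randomness uniform on `M` values. Both maps may use
private randomness: `enc u c` is the conditional distribution of `Xⁿ` given `(Uⁿ, C) = (u, c)`, and
`dec y c` is the conditional distribution of `Vⁿ` given `(Yⁿ, C) = (y, c)`. -/
structure Code (U X Y V : Type*) [Fintype X] [Fintype V] (n M : ℕ) where
  enc : (Fin n → U) → Fin M → (Fin n → X) → ℝ
  enc_mem : ∀ u c, enc u c ∈ stdSimplex ℝ (Fin n → X)
  dec : (Fin n → Y) → Fin M → (Fin n → V) → ℝ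
  dec_mem : ∀ y c, dec y c ∈ stdSimplex ℝ (Fin n → V)

/-- The distribution of `(Uⁿ, Xⁿ, Yⁿ, Vⁿ)` induced by a code, for the i.i.d. source `PU` and the
memoryless channel `PYX`. -/
def Code.induced {n M : ℕ} (c : Code U X Y V n M) (PU : U → ℝ) (PYX : X → Y → ℝ)
    (u : Fin n → U) (x : Fin n → X) (y : Fin n → Y) (v : Fin n → V) : ℝ :=
  ∑ k : Fin M, (1 / (M : ℝ)) *
    ((∏ i, PU (u i)) * c.enc u k x * (∏ i, PYX (x i) (y i)) * c.dec y k v)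

/-- The `L¹` distance between the distribution induced by a code and the i.i.d. target. -/
def Code.l1Dist {n M : ℕ} (c : Code U X Y V n M) (PU : U → ℝ) (PYX : X → Y → ℝ)
    (P : U × X × Y × V → ℝ) : ℝ :=
  ∑ u : Fin n → U, ∑ x : Fin n → X, ∑ y : Fin n → Y, ∑ v : Fin n → V,
    |c.induced PU PYX u x y v - ∏ i, P (u i, x i, y i, v i)|

/-- The target `P` is `(ε, n)`-achievable for strong coordination with common randomness rate `R₀`,
that is, with common randomness uniform on the integers between `1` and `2 ^ (n R₀)`. -/
def Achievable (PU : U → ℝ) (PYX : X → Y → ℝ) (n : ℕ) (ε : ℝ)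
    (P : U × X × Y × V → ℝ) (R₀ : ℝ) : Prop :=
  P ∈ stdSimplex ℝ (U × X × Y × V) ∧ 0 ≤ R₀ ∧
    ∃ c : Code U X Y V n ⌊(2 : ℝ) ^ ((n : ℝ) * R₀)⌋₊, c.l1Dist PU PYX P ≤ ε

/-- The fixed-length strong coordination region for block length `n` and `L¹` distance `ε`. -/
def coordinationRegion (PU : U → ℝ) (PYX : X → Y → ℝ) (n : ℕ) (ε : ℝ) :
    Set ((U × X × Y × V → ℝ) × ℝ) :=
  closure {p | Achievable PU PYX n ε p.1 p.2}

end Coordination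

/-! ### The inner region -/

section Inner

variable {U W X Y V : Type*} [Fintype U] [Fintype W] [Fintype X] [Fintype Y] [Fintype V]

/-- Joint outcomes, in the order `(U, W, X, Y, V)`. -/
abbrev Outcome (U W X Y V : Type*) := U × W × X × Y × V

/-- The coordinate random variables on the space of outcomes. -/
def rvU (ω : Outcome U W X Y V) : U := ω.1
def rvW (ω : Outcome U W X Y V) : W := ω.2.1
def rvX (ω : Outcome U W X Y V) : X := ω.2.2.1
def rvY (ω : Outcome U W X Y V) : Y := ω.2.2.2.1
def rvV (ω : Outcome U W X Y V) : V := ω.2.2.2.2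

/-- `J = P_U P_{W|U} P_{X|UW} P_{Y|X} P_{V|WY}` for some conditional distributions `P_{W|U}`,
`P_{X|UW}`, `P_{V|WY}`, where the source `P_U` and the channel `P_{Y|X}` are given. -/
def Factorizes (PU : U → ℝ) (PYX : X → Y → ℝ) (J : Outcome U W X Y V → ℝ) : Prop :=
  ∃ (PW : U → W → ℝ) (PX : U → W → X → ℝ) (PV : W → Y → V → ℝ),
    (∀ u, PW u ∈ stdSimplex ℝ W) ∧ (∀ u w, PX u w ∈ stdSimplex ℝ X) ∧
    (∀ w y, PV w y ∈ stdSimplex ℝ V) ∧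
    ∀ u w x y v, J (u, w, x, y, v) = PU u * PW u w * PX u w x * PYX x y * PV w y v

/-- The dispersion of the channel `P_{Y|W}`, whose inputs are the `w` with `P_W(w) > 0`. -/
def channelDispersion (J : Outcome U W X Y V → ℝ) : ℝ :=
  dispersion (condLaw J rvW rvY) {w | 0 < law J rvW w}

/-- The constant `H(U,W) + H(U)` in front of the typicality parameter in the first rate
condition. -/
def const₁ (J : Outcome U W X Y V → ℝ) : ℝ :=
  entropy J (fun ω => (rvU ω, rvW ω)) + entropy J rvU

/-- The constant `H(U,W,X,Y,V) + H(W)` in front of the typicality parameter in the second rate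
condition. -/
def const₃ (J : Outcome U W X Y V → ℝ) : ℝ :=
  entropy J (fun ω => ω) + entropy J rvW

/-- The inner region for block length `n`, typicality parameter `ε₁` and error parameter `ε₅`, with
auxiliary alphabet `W`. The two coefficients `κ` and `B`, which may depend on the joint distribution
`J`, are those of the terms of order `log n / n` and `1 / √n`.
The target `P_{UXYV}` is the marginal of `J`, so that it has the form
`P_U P_{X|U} P_{Y|X} P_{V|UXY}`. -/
def innerRegion (PU : U → ℝ) (PYX : X → Y → ℝ) (n : ℕ) (ε₁ ε₅ : ℝ)
    (κ B : (Outcome U W X Y V → ℝ) → ℝ) : Set ((U × X × Y × V → ℝ) × ℝ) :=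
  {p | ∃ J : Outcome U W X Y V → ℝ,
    Factorizes PU PYX J ∧
    law J (fun ω => (rvU ω, rvX ω, rvY ω, rvV ω)) = p.1 ∧
    0 < ε₅ + B J / Real.sqrt n ∧ ε₅ + B J / Real.sqrt n ≤ 1 / 2 ∧
    mutualInfo J rvW rvU ≤ mutualInfo J rvW rvY -
      (const₁ J * ε₁ + κ J * (Real.logb 2 n / n)
        + gaussianQInv (ε₅ + B J / Real.sqrt n) * Real.sqrt (channelDispersion J / n)) ∧
    condMutualInfo J rvW (fun ω => (rvU ω, rvX ω, rvV ω)) rvY +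
      (const₃ J * ε₁ + κ J * (Real.logb 2 n / n)
        + gaussianQInv (ε₅ + B J / Real.sqrt n) * Real.sqrt (channelDispersion J / n)) ≤ p.2}

end Inner

end

end StrongCoord

/-!
The auxiliary variable `W` turns the joint distribution into a test channel from `W` to
`(U, X, Y, V)`. Draw a random codebook, indexed by the common randomness `k` and a local message
`l`. In the ideal process `l` is uniform and `(U, X, Y, V)ⁿ` is the output of the test channel for
the codeword at `(k, l)`. Soft covering makes two of its outputs almost i.i.d.: with both indices
averaged out, all of `(U, X, Y, V)ⁿ`, and, for a fixed `k`, the source `Uⁿ`. The encoder can thus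
draw `l` from its posterior given the true source word, and the decoder, who sees `(Yⁿ, k)`,
recovers `l` by drawing it from its own posterior. The three errors are tails of information
densities, which Hoeffding's inequality bounds as soon as the rates exceed the mutual informations
by a constant times `√(log n / n)`.

If `n ε₁ ^ 2` is at least a constant times `log n`, the terms in `ε₁` of the rate conditions provide
this excess. If it is smaller, the coefficient of `log n / n` may be chosen so large that no
distribution satisfies the conditions.
-/

namespace StrongCoord

noncomputable section

/-! ### Finite distributions and i.i.d. families -/

section Mean

variable {Ω Ω' : Type*} [Fintype Ω] [Fintype Ω']

/-- The mean of the random variable `F` under the weights `P`. -/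
def mean (P F : Ω → ℝ) : ℝ := ∑ ω, P ω * F ω

/-- The probability of the event `s` under the distribution `P`. -/
def prob (P : Ω → ℝ) (s : Set Ω) : ℝ := ∑ ω, s.indicator P ω

lemma mean_add (P F G : Ω → ℝ) : mean P (fun ω => F ω + G ω) = mean P F + mean P G := by
  simp only [mean, mul_add, Finset.sum_add_distrib]

lemma mean_sub (P F G : Ω → ℝ) : mean P (fun ω => F ω - G ω) = mean P F - mean P G := by
  simp only [mean, mul_sub, Finset.sum_sub_distrib]

lemma mean_const_mul (P : Ω → ℝ) (a : ℝ) (F : Ω → ℝ) :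
    mean P (fun ω => a * F ω) = a * mean P F := by
  simp only [mean, Finset.mul_sum, mul_left_comm]

lemma mean_div_const (P F : Ω → ℝ) (a : ℝ) : mean P (fun ω => F ω / a) = mean P F / a := by
  simp only [mean, Finset.sum_div, mul_div_assoc]

lemma mean_sum {κ : Type*} (s : Finset κ) (P : Ω → ℝ) (F : κ → Ω → ℝ) :
    mean P (fun ω => ∑ k ∈ s, F k ω) = ∑ k ∈ s, mean P (F k) := by
  simp only [mean, Finset.mul_sum]
  exact Finset.sum_comm

lemma mean_const {P : Ω → ℝ} (hP : P ∈ stdSimplex ℝ Ω) (a : ℝ) : mean P (fun _ => a) = a := by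
  rw [mean, ← Finset.sum_mul, hP.2, one_mul]

lemma mean_mono {P F G : Ω → ℝ} (hP : ∀ ω, 0 ≤ P ω) (h : ∀ ω, F ω ≤ G ω) :
    mean P F ≤ mean P G :=
  Finset.sum_le_sum fun ω _ => mul_le_mul_of_nonneg_left (h ω) (hP ω)

lemma mean_congr {P F G : Ω → ℝ} (h : ∀ ω, P ω ≠ 0 → F ω = G ω) : mean P F = mean P G :=
  Finset.sum_congr rfl fun ω _ => by
    rcases eq_or_ne (P ω) 0 with hω | hω
    · rw [hω, zero_mul, zero_mul]
    · rw [h ω hω]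

lemma mean_nonneg {P F : Ω → ℝ} (hP : ∀ ω, 0 ≤ P ω) (hF : ∀ ω, 0 ≤ F ω) : 0 ≤ mean P F :=
  Finset.sum_nonneg fun ω _ => mul_nonneg (hP ω) (hF ω)

lemma mean_comp_equiv (e : Ω ≃ Ω') (P F : Ω' → ℝ) : mean (P ∘ e) (F ∘ e) = mean P F :=
  e.sum_comp fun ω => P ω * F ω

lemma exists_le_of_mean_le {P F : Ω → ℝ} (hP : P ∈ stdSimplex ℝ Ω) {a : ℝ}
    (h : mean P F ≤ a) : ∃ ω, F ω ≤ a := by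
  have hsum : ∑ ω, P ω * F ω ≤ ∑ ω, P ω * a := by rwa [← Finset.sum_mul, hP.2, one_mul]
  obtain ⟨ω, hω, hle⟩ : ∃ ω, P ω ≠ 0 ∧ P ω * F ω ≤ P ω * a := by
    by_contra! hlt
    obtain ⟨ω, hω⟩ : ∃ ω, P ω ≠ 0 := by
      by_contra! hzero
      simpa [hzero] using hP.2
    refine hsum.not_gt (Finset.sum_lt_sum (fun ω' _ => ?_) ⟨ω, Finset.mem_univ ω, hlt ω hω⟩)
    by_cases hω' : P ω' = 0
    · simp [hω']
    · exact (hlt ω' hω').le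
  exact ⟨ω, le_of_mul_le_mul_left hle ((hP.1 ω).lt_of_ne' hω)⟩

lemma mean_abs_le_sqrt_mean_sq {P : Ω → ℝ} (hP : P ∈ stdSimplex ℝ Ω) (F : Ω → ℝ) :
    mean P (fun ω => |F ω|) ≤ √(mean P fun ω => F ω ^ 2) := by
  refine Real.le_sqrt_of_sq_le ?_
  simpa only [mean, sq_abs] using Real.pow_arith_mean_le_arith_mean_pow_of_even Finset.univ P
    (fun ω => |F ω|) (fun ω _ => hP.1 ω) hP.2 even_two

lemma mean_sub_mean_sq_le {P : Ω → ℝ} (hP : P ∈ stdSimplex ℝ Ω) (F : Ω → ℝ) :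
    mean P (fun ω => (F ω - mean P F) ^ 2) ≤ mean P (fun ω => F ω ^ 2) := by
  set m := mean P F with hm
  have hexpand : mean P (fun ω => (F ω - m) ^ 2) = mean P (fun ω => F ω ^ 2) - m ^ 2 :=
    calc mean P (fun ω => (F ω - m) ^ 2)
        = mean P (fun ω => F ω ^ 2 - (2 * m) * F ω + m ^ 2) := by
          congr 1; funext ω; ring
      _ = mean P (fun ω => F ω ^ 2) - m ^ 2 := by
          rw [mean_add, mean_sub, mean_const_mul, mean_const hP, ← hm]; ring
  linarith [sq_nonneg m]

lemma prob_eq_mean (P : Ω → ℝ) (s : Set Ω) : prob P s = mean P (s.indicator 1) :=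
  Finset.sum_congr rfl fun ω _ => by by_cases h : ω ∈ s <;> simp [h]

lemma prob_le_one {P : Ω → ℝ} (hP : P ∈ stdSimplex ℝ Ω) (s : Set Ω) : prob P s ≤ 1 :=
  (Finset.sum_le_sum fun ω _ => Set.indicator_le_self' (fun _ _ => hP.1 ω) ω).trans_eq hP.2

lemma prob_mono {P : Ω → ℝ} (hP : ∀ ω, 0 ≤ P ω) {s t : Set Ω}
    (h : ∀ ω, P ω ≠ 0 → ω ∈ s → ω ∈ t) : prob P s ≤ prob P t := by
  refine Finset.sum_le_sum fun ω _ => ?_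
  by_cases hs : ω ∈ s
  · by_cases hω : P ω = 0
    · rw [Set.indicator_of_mem hs, hω]
      exact Set.indicator_nonneg (fun ω _ => hP ω) ω
    · simp [hs, h ω hω hs]
  · simpa [hs] using Set.indicator_nonneg (fun ω _ => hP ω) ω

lemma mul_prob_le_mean {P F : Ω → ℝ} (hP : ∀ ω, 0 ≤ P ω) (hF : ∀ ω, 0 ≤ F ω) {s : Set Ω}
    {a : ℝ} (h : ∀ ω ∈ s, a ≤ F ω) : a * prob P s ≤ mean P F := by
  rw [prob_eq_mean, ← mean_const_mul]
  refine mean_mono hP fun ω => ?_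
  by_cases hω : ω ∈ s
  · simpa [hω] using h ω hω
  · simpa [hω] using hF ω

end Mean

section Channel

variable {W Z : Type*} [Fintype W] [Fintype Z]

/-- The joint distribution of the input and the output of the channel `K` for the input
distribution `p`. -/
def jointLaw (p : W → ℝ) (K : W → Z → ℝ) (ω : W × Z) : ℝ := p ω.1 * K ω.1 ω.2

lemma jointLaw_mem {p : W → ℝ} (hp : p ∈ stdSimplex ℝ W) {K : W → Z → ℝ}
    (hK : ∀ w, K w ∈ stdSimplex ℝ Z) : jointLaw p K ∈ stdSimplex ℝ (W × Z) :=
  ⟨fun ω => mul_nonneg (hp.1 ω.1) ((hK ω.1).1 ω.2), by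
    simp only [jointLaw, Fintype.sum_prod_type, ← Finset.mul_sum, (hK _).2, mul_one, hp.2]⟩

lemma outputLaw_mem {p : W → ℝ} (hp : p ∈ stdSimplex ℝ W) {K : W → Z → ℝ}
    (hK : ∀ w, K w ∈ stdSimplex ℝ Z) : outputLaw K p ∈ stdSimplex ℝ Z := by
  refine ⟨fun z => Finset.sum_nonneg fun w _ => mul_nonneg (hp.1 w) ((hK w).1 z), ?_⟩
  simp only [outputLaw]
  rw [Finset.sum_comm]
  simp only [← Finset.mul_sum, (hK _).2, mul_one, hp.2]

lemma mean_jointLaw (p : W → ℝ) (K : W → Z → ℝ) (F : W × Z → ℝ) :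
    mean (jointLaw p K) F = ∑ w, p w * ∑ z, K w z * F (w, z) := by
  simp only [mean, jointLaw, Fintype.sum_prod_type, Finset.mul_sum, mul_assoc]

end Channel

section ProdLaw

variable {ι W : Type*} [Fintype ι] [DecidableEq ι] [Fintype W]

/-- The joint law of independent random variables, the `i`-th having distribution `P i`. -/
def prodLaw {ι W : Type*} [Fintype ι] (P : ι → W → ℝ) (c : ι → W) : ℝ := ∏ i, P i (c i)

/-- The joint law of i.i.d. random variables with distribution `p`. -/
abbrev powLaw {ι W : Type*} [Fintype ι] (p : W → ℝ) : (ι → W) → ℝ := prodLaw fun _ => p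

lemma mean_prodLaw_prod (P f : ι → W → ℝ) :
    mean (prodLaw P) (fun c => ∏ i, f i (c i)) = ∏ i, mean (P i) (f i) := by
  simp only [mean, prodLaw, ← Finset.prod_mul_distrib, Fintype.prod_sum]

lemma prodLaw_mem {P : ι → W → ℝ} (hP : ∀ i, P i ∈ stdSimplex ℝ W) :
    prodLaw P ∈ stdSimplex ℝ (ι → W) :=
  ⟨fun _ => Finset.prod_nonneg fun i _ => (hP i).1 _, by
    simpa [mean, (hP _).2] using mean_prodLaw_prod P fun _ _ => 1⟩

lemma mean_powLaw_curry {κ : Type*} [Fintype κ] [DecidableEq κ] (p : W → ℝ)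
    (F : (ι → κ → W) → ℝ) :
    mean (powLaw (powLaw p)) F = mean (powLaw p) (fun c : ι × κ → W => F (Function.curry c)) := by
  rw [← mean_comp_equiv (Equiv.curry ι κ W)]
  refine congrArg (mean · _) (funext fun c => ?_)
  simp [prodLaw, Fintype.prod_prod_type]

lemma mean_powLaw_eval_mul {p : W → ℝ} (hp : p ∈ stdSimplex ℝ W) {j k : ι} (hjk : j ≠ k)
    (f g : W → ℝ) :
    mean (powLaw p) (fun c => f (c j) * g (c k)) = mean p f * mean p g := by
  have h := mean_prodLaw_prod (ι := ι) (fun _ => p) fun i =>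
    if i = j then f else if i = k then g else 1
  have hone : mean p 1 = 1 := mean_const hp 1
  rw [Fintype.prod_eq_mul j k hjk (fun i hi => by simp [hi.1, hi.2, hone])] at h
  simp only [if_true, if_neg hjk.symm] at h
  rw [← h]
  refine congrArg _ (funext fun c => ?_)
  rw [Fintype.prod_eq_mul j k hjk (fun i hi => by simp [hi.1, hi.2])]
  simp [hjk.symm]

lemma mean_powLaw_eval {p : W → ℝ} (hp : p ∈ stdSimplex ℝ W) (j : ι) (f : W → ℝ) :
    mean (powLaw p) (fun c => f (c j)) = mean p f := by
  have h := mean_prodLaw_prod (ι := ι) (fun _ => p) fun i => if i = j then f else 1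
  have hone : mean p 1 = 1 := mean_const hp 1
  rw [Fintype.prod_eq_single j (fun i hi => by simp [hi, hone])] at h
  simp only [if_true] at h
  rw [← h]
  refine congrArg _ (funext fun c => ?_)
  rw [Fintype.prod_eq_single j (fun i hi => by simp [hi])]
  simp

lemma mean_powLaw_sum_sq {p : W → ℝ} (hp : p ∈ stdSimplex ℝ W) {f : W → ℝ}
    (hf : mean p f = 0) :
    mean (powLaw p) (fun c : ι → W => (∑ i, f (c i)) ^ 2) =
      Fintype.card ι * mean p (fun w => f w ^ 2) := by
  simp only [sq, Finset.sum_mul_sum, mean_sum]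
  rw [← nsmul_eq_mul, ← Finset.card_univ, ← Finset.sum_const]
  refine Finset.sum_congr rfl fun j _ => ?_
  rw [Fintype.sum_eq_single j fun k hk => by rw [mean_powLaw_eval_mul hp hk.symm, hf, zero_mul]]
  exact mean_powLaw_eval hp j fun w => f w * f w

lemma mean_powLaw_average [Nonempty ι] {p : W → ℝ} (hp : p ∈ stdSimplex ℝ W) (f : W → ℝ) :
    mean (powLaw p) (fun c : ι → W => (∑ i, f (c i)) / Fintype.card ι) = mean p f := by
  rw [mean_div_const, mean_sum, Finset.sum_congr rfl fun i _ => mean_powLaw_eval hp i f]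
  simp

lemma mean_abs_average_sub_le_sqrt [Nonempty ι] {p : W → ℝ} (hp : p ∈ stdSimplex ℝ W)
    (f : W → ℝ) :
    mean (powLaw p) (fun c : ι → W => |(∑ i, f (c i)) / Fintype.card ι - mean p f|) ≤
      √(mean p (fun w => f w ^ 2) / Fintype.card ι) := by
  refine (mean_abs_le_sqrt_mean_sq (prodLaw_mem fun _ => hp) _).trans (Real.sqrt_le_sqrt ?_)
  have hcentred (c : ι → W) : ((∑ i, f (c i)) / Fintype.card ι - mean p f) ^ 2 =
      (∑ i, (f (c i) - mean p f)) ^ 2 / (Fintype.card ι : ℝ) ^ 2 := by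
    rw [Finset.sum_sub_distrib, Finset.sum_const, Finset.card_univ, nsmul_eq_mul, ← div_pow]
    field_simp
  simp only [hcentred]
  rw [mean_div_const, mean_powLaw_sum_sq (f := fun w => f w - mean p f) hp
    (by rw [mean_sub, mean_const hp, sub_self]), sq, mul_div_mul_left _ _ (by positivity)]
  gcongr
  exact mean_sub_mean_sq_le hp f

lemma mean_abs_average_sub_le_two_mul [Nonempty ι] {p : W → ℝ} (hp : p ∈ stdSimplex ℝ W)
    {f : W → ℝ} (hf : ∀ w, 0 ≤ f w) :
    mean (powLaw p) (fun c : ι → W => |(∑ i, f (c i)) / Fintype.card ι - mean p f|) ≤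
      2 * mean p f := by
  have hm : 0 ≤ mean p f := mean_nonneg hp.1 hf
  calc mean (powLaw p) (fun c : ι → W => |(∑ i, f (c i)) / Fintype.card ι - mean p f|)
      ≤ mean (powLaw p) (fun c : ι → W => (∑ i, f (c i)) / Fintype.card ι + mean p f) := by
        refine mean_mono (prodLaw_mem fun _ => hp).1 fun c => ?_
        have : 0 ≤ (∑ i, f (c i)) / Fintype.card ι :=
          div_nonneg (Finset.sum_nonneg fun i _ => hf _) (Nat.cast_nonneg _)
        exact abs_le.2 ⟨by linarith, by linarith⟩
    _ = 2 * mean p f := by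
        rw [mean_add, mean_powLaw_average hp, mean_const (prodLaw_mem fun _ => hp), two_mul]

lemma mean_abs_average_sub_le [Nonempty ι] {p : W → ℝ} (hp : p ∈ stdSimplex ℝ W) {f : W → ℝ}
    (hf : ∀ w, 0 ≤ f w) (s : Set W) :
    mean (powLaw p) (fun c : ι → W => |(∑ i, f (c i)) / Fintype.card ι - mean p f|) ≤
      √(mean p (fun w => sᶜ.indicator f w ^ 2) / Fintype.card ι) +
        2 * mean p (s.indicator f) := by
  have hsplit (w : W) : f w = sᶜ.indicator f w + s.indicator f w :=
    (congrFun (Set.indicator_compl_add_self s f) w).symm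
  have hmean : mean p f = mean p (sᶜ.indicator f) + mean p (s.indicator f) := by
    rw [← mean_add]; exact congrArg _ (funext hsplit)
  refine le_trans ?_ (add_le_add (mean_abs_average_sub_le_sqrt (ι := ι) hp _)
    (mean_abs_average_sub_le_two_mul (ι := ι) hp <| Set.indicator_nonneg fun w _ => hf w))
  rw [← mean_add]
  refine mean_mono (prodLaw_mem fun _ => hp).1 fun c =>
    le_of_eq_of_le (congrArg abs ?_) (abs_add_le _ _)
  rw [hmean, Finset.sum_congr rfl fun i _ => hsplit (c i), Finset.sum_add_distrib]
  ring

end ProdLaw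

/-! ### Soft covering and the likelihood decoder -/

section RandomCodebook

variable {W Z κ : Type*} [Fintype W] [Fintype Z] [Fintype κ]

/-- The probability that the likelihood ratio `K w z / outputLaw K p z` exceeds `θ`. -/
def densityUpperTail (p : W → ℝ) (K : W → Z → ℝ) (θ : ℝ) : ℝ :=
  prob (jointLaw p K) {ω | θ * outputLaw K p ω.2 < K ω.1 ω.2}

/-- The probability that the likelihood ratio `K w z / outputLaw K p z` is at most `θ`. -/
def densityLowerTail (p : W → ℝ) (K : W → Z → ℝ) (θ : ℝ) : ℝ :=
  prob (jointLaw p K) {ω | K ω.1 ω.2 ≤ θ * outputLaw K p ω.2}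

lemma prob_jointLaw_eq_sum_mean (p : W → ℝ) (K : W → Z → ℝ) (s : Set (W × Z)) :
    prob (jointLaw p K) s = ∑ z, mean p ({w | (w, z) ∈ s}.indicator fun w => K w z) := by
  rw [prob, Fintype.sum_prod_type_right]
  refine Finset.sum_congr rfl fun z _ => Finset.sum_congr rfl fun w _ => ?_
  by_cases h : (w, z) ∈ s <;> simp [h, jointLaw]

lemma mean_indicator_sq_le {p f : W → ℝ} (hp : ∀ w, 0 ≤ p w) (hf : ∀ w, 0 ≤ f w) {θ : ℝ}
    (hθ : 0 ≤ θ) :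
    mean p (fun w => {w | θ < f w}ᶜ.indicator f w ^ 2) ≤ θ * mean p f := by
  rw [← mean_const_mul]
  refine mean_mono hp fun w => ?_
  by_cases h : θ < f w
  · simpa [h] using mul_nonneg hθ (hf w)
  · simpa [h, sq] using mul_le_mul_of_nonneg_right (not_lt.1 h) (hf w)

lemma mean_softCovering_le [DecidableEq κ] [Nonempty κ] {p : W → ℝ} (hp : p ∈ stdSimplex ℝ W)
    {K : W → Z → ℝ} (hK : ∀ w, K w ∈ stdSimplex ℝ Z) {θ : ℝ} (hθ : 0 ≤ θ) :
    mean (powLaw p) (fun c : κ → W =>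
      ∑ z, |(∑ k, K (c k) z) / Fintype.card κ - outputLaw K p z|) ≤
      √(θ / Fintype.card κ) + 2 * densityUpperTail p K θ := by
  have hq := outputLaw_mem hp hK
  have hoverflow (z : Z) :
      √(mean p (fun w => {w | θ * outputLaw K p z < K w z}ᶜ.indicator (K · z) w ^ 2) /
        Fintype.card κ) ≤ outputLaw K p z * √(θ / Fintype.card κ) :=
    calc _ ≤ √(outputLaw K p z ^ 2 * (θ / Fintype.card κ)) := by
          refine Real.sqrt_le_sqrt ?_
          rw [← mul_div_assoc]
          gcongr
          refine (mean_indicator_sq_le hp.1 (fun w => (hK w).1 z)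
            (mul_nonneg hθ (hq.1 z))).trans_eq ?_
          change θ * outputLaw K p z * outputLaw K p z = _
          ring
      _ = _ := by rw [Real.sqrt_mul (sq_nonneg _), Real.sqrt_sq (hq.1 z)]
  rw [mean_sum, densityUpperTail, prob_jointLaw_eq_sum_mean, Finset.mul_sum]
  calc _ ≤ ∑ z, (outputLaw K p z * √(θ / Fintype.card κ) +
        2 * mean p ({w | θ * outputLaw K p z < K w z}.indicator fun w => K w z)) :=
        Finset.sum_le_sum fun z _ =>
          (mean_abs_average_sub_le hp (fun w => (hK w).1 z) _).trans
            (add_le_add (hoverflow z) le_rfl)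
    _ = _ := by rw [Finset.sum_add_distrib, ← Finset.sum_mul, hq.2, one_mul]; rfl

/-- Normalisation of a vector of nonnegative likelihoods to a distribution; when all likelihoods
vanish the result is uniform, so that it is always a distribution. -/
def normalize (a : κ → ℝ) (k : κ) : ℝ :=
  if ∑ k', a k' = 0 then 1 / Fintype.card κ else a k / ∑ k', a k'

lemma normalize_mem [Nonempty κ] {a : κ → ℝ} (ha : ∀ k, 0 ≤ a k) :
    normalize a ∈ stdSimplex ℝ κ := by
  unfold normalize
  by_cases h : ∑ k, a k = 0
  · simp only [h, if_true]
    exact ⟨fun _ => by positivity, by simp⟩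
  · simp only [h, if_false]
    exact ⟨fun k => div_nonneg (ha k) (Finset.sum_nonneg fun k _ => ha k), by
      rw [← Finset.sum_div, div_self h]⟩

lemma normalize_mul_sum {a : κ → ℝ} (ha : ∀ k, 0 ≤ a k) (k : κ) :
    normalize a k * ∑ k', a k' = a k := by
  unfold normalize
  split_ifs with h
  · rw [h, mul_zero, (Finset.sum_eq_zero_iff_of_nonneg fun k _ => ha k).1 h k (Finset.mem_univ k)]
  · rw [div_mul_cancel₀ _ h]

lemma le_one_of_mem_stdSimplex {D : κ → ℝ} (hD : D ∈ stdSimplex ℝ κ) (k : κ) : D k ≤ 1 :=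
  hD.2 ▸ Finset.single_le_sum (fun i _ => hD.1 i) (Finset.mem_univ k)

variable [DecidableEq κ] [Nonempty κ]

lemma mul_one_sub_normalize_le_sum_erase {a : κ → ℝ} (ha : ∀ k, 0 ≤ a k) (k : κ) :
    a k * (1 - normalize a k) ≤ ∑ k' ∈ Finset.univ.erase k, a k' := by
  have hD := normalize_mem ha
  have hrest : 0 ≤ ∑ k' ∈ Finset.univ.erase k, a k' := Finset.sum_nonneg fun k _ => ha k
  have hmul := normalize_mul_sum ha k
  rw [← Finset.add_sum_erase _ _ (Finset.mem_univ k)] at hmul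
  linarith [mul_le_mul_of_nonneg_right (le_one_of_mem_stdSimplex hD k) hrest]

lemma mul_one_sub_normalize_le {a : κ → ℝ} (ha : ∀ k, 0 ≤ a k) (k : κ) {t : ℝ} (ht₀ : 0 ≤ t)
    (ht₁ : t ≤ 1) :
    a k * (1 - normalize a k) ≤ (1 - t) * a k + ∑ k' ∈ Finset.univ.erase k, t * a k' := by
  have hself : a k * (1 - normalize a k) ≤ a k := by
    nlinarith [mul_nonneg (ha k) ((normalize_mem ha).1 k)]
  rw [← Finset.mul_sum]
  linarith [mul_le_mul_of_nonneg_left hself (sub_nonneg.2 ht₁),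
    mul_le_mul_of_nonneg_left (mul_one_sub_normalize_le_sum_erase ha k) ht₀]

lemma mean_mul_one_sub_normalize_le {p : W → ℝ} (hp : p ∈ stdSimplex ℝ W) {f : W → ℝ}
    (hf : ∀ w, 0 ≤ f w) (s : Set W) (k : κ) :
    mean (powLaw p) (fun c : κ → W => f (c k) * (1 - normalize (fun k' => f (c k')) k)) ≤
      mean p (sᶜ.indicator f) + Fintype.card κ * (prob p s * mean p f) := by
  have ht₀ (w : W) : 0 ≤ s.indicator (1 : W → ℝ) w :=
    Set.indicator_nonneg (fun _ _ => zero_le_one) w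
  have ht₁ (w : W) : s.indicator (1 : W → ℝ) w ≤ 1 :=
    Set.indicator_le_self' (fun _ _ => zero_le_one) w
  calc _ ≤ mean (powLaw p) (fun c : κ → W => (1 - s.indicator 1 (c k)) * f (c k) +
        ∑ k' ∈ Finset.univ.erase k, s.indicator 1 (c k) * f (c k')) :=
        mean_mono (prodLaw_mem fun _ => hp).1 fun c =>
          mul_one_sub_normalize_le (fun _ => hf _) k (ht₀ _) (ht₁ _)
    _ = mean p (fun w => (1 - s.indicator 1 w) * f w) +
        ∑ _k' ∈ Finset.univ.erase k, prob p s * mean p f := by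
        rw [mean_add, mean_sum,
          mean_powLaw_eval hp k fun w => (1 - s.indicator 1 w) * f w, prob_eq_mean]
        exact congrArg _ (Finset.sum_congr rfl fun k' hk' =>
          mean_powLaw_eval_mul hp (Finset.ne_of_mem_erase hk').symm _ f)
    _ ≤ _ := by
        refine add_le_add (le_of_eq (congrArg _ (funext fun w => ?_))) ?_
        · by_cases h : w ∈ s <;> simp [h]
        · rw [Finset.sum_const, nsmul_eq_mul]
          refine mul_le_mul_of_nonneg_right (mod_cast Finset.card_le_univ _) (mul_nonneg ?_ ?_)
          · exact Finset.sum_nonneg fun w _ => Set.indicator_nonneg (fun w _ => hp.1 w) w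
          · exact mean_nonneg hp.1 hf

lemma mean_likelihoodDecoder_le {p : W → ℝ} (hp : p ∈ stdSimplex ℝ W) {K : W → Z → ℝ}
    (hK : ∀ w, K w ∈ stdSimplex ℝ Z) (k : κ) {θ : ℝ} (hθ : 0 < θ) :
    mean (powLaw p) (fun c : κ → W =>
      ∑ z, K (c k) z * (1 - normalize (fun k' => K (c k') z) k)) ≤
      densityLowerTail p K θ + Fintype.card κ / θ := by
  have hq := outputLaw_mem hp hK
  have hmarkov (z : Z) : prob p {w | θ * outputLaw K p z < K w z} * outputLaw K p z ≤
      outputLaw K p z / θ := by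
    have h := mul_prob_le_mean hp.1 (fun w => (hK w).1 z)
      (s := {w | θ * outputLaw K p z < K w z}) (fun _ hw => le_of_lt hw)
    rw [le_div_iff₀ hθ]
    exact le_of_eq_of_le (by ring) h
  rw [mean_sum, densityLowerTail, prob_jointLaw_eq_sum_mean]
  calc _ ≤ ∑ z, (mean p ({w | θ * outputLaw K p z < K w z}ᶜ.indicator fun w => K w z) +
        Fintype.card κ * (outputLaw K p z / θ)) :=
        Finset.sum_le_sum fun z _ =>
          (mean_mul_one_sub_normalize_le hp (fun w => (hK w).1 z) _ k).trans
            (add_le_add_right (mul_le_mul_of_nonneg_left (hmarkov z) (Nat.cast_nonneg _)) _)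
    _ = _ := by
        rw [Finset.sum_add_distrib, ← Finset.mul_sum, ← Finset.sum_div, hq.2, mul_one_div]
        simp only [Set.compl_ofPred, not_lt, Set.mem_ofPred_eq]

end RandomCodebook

/-! ### The one-shot code of a codebook -/

section Posterior

variable {W A B κ : Type*} [Fintype κ]

lemma sum_abs_mixture_sub_le [Fintype B] {D : κ → ℝ} (hD : D ∈ stdSimplex ℝ κ)
    {Q : κ → B → ℝ} (hQ : ∀ k, Q k ∈ stdSimplex ℝ B) (k : κ) :
    ∑ b, |∑ k', D k' * Q k' b - Q k b| ≤ 2 * (1 - D k) := by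
  classical
  have htriangle (b : B) : |∑ k', D k' * Q k' b - Q k b| ≤
      ∑ k' ∈ Finset.univ.erase k, D k' * (Q k' b + Q k b) := by
    have hdiff : ∑ k', D k' * Q k' b - Q k b =
        ∑ k' ∈ Finset.univ.erase k, D k' * (Q k' b - Q k b) := by
      rw [Finset.sum_erase _ (by ring)]
      simp only [mul_sub, Finset.sum_sub_distrib, ← Finset.sum_mul, hD.2, one_mul]
    rw [hdiff]
    refine (Finset.abs_sum_le_sum_abs _ _).trans (Finset.sum_le_sum fun k' _ => ?_)
    rw [abs_mul, abs_of_nonneg (hD.1 k')]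
    refine mul_le_mul_of_nonneg_left ?_ (hD.1 k')
    exact abs_le.2 ⟨by linarith [(hQ k').1 b], by linarith [(hQ k).1 b]⟩
  calc ∑ b, |∑ k', D k' * Q k' b - Q k b|
      ≤ ∑ b, ∑ k' ∈ Finset.univ.erase k, D k' * (Q k' b + Q k b) :=
        Finset.sum_le_sum fun b _ => htriangle b
    _ = (∑ k' ∈ Finset.univ.erase k, D k') * 2 := by
        rw [Finset.sum_comm, Finset.sum_mul]
        simp only [← Finset.mul_sum, Finset.sum_add_distrib, (hQ _).2, one_add_one_eq_two]
    _ = 2 * (1 - D k) := by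
        rw [← hD.2, ← Finset.add_sum_erase _ D (Finset.mem_univ k)]
        ring

/-- The output distribution of the channel `F a` whose input is a codeword of `c`, drawn with its
posterior probability given that the uniformly chosen codeword went through `K` and came out
as `a`. -/
def posteriorMap (K : W → A → ℝ) (F : A → W → B → ℝ) (c : κ → W) (a : A) (b : B) : ℝ :=
  ∑ k, normalize (fun k' => K (c k') a) k * F a (c k) b

lemma posteriorMap_mem [Fintype B] [Nonempty κ] {K : W → A → ℝ} {F : A → W → B → ℝ}
    (hK : ∀ w a, 0 ≤ K w a) (hF : ∀ a w, F a w ∈ stdSimplex ℝ B) (c : κ → W) (a : A) :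
    posteriorMap K F c a ∈ stdSimplex ℝ B := by
  have h := normalize_mem fun k => hK (c k) a
  refine ⟨fun b => Finset.sum_nonneg fun k _ => mul_nonneg (h.1 k) ((hF _ _).1 b), ?_⟩
  simp only [posteriorMap]
  rw [Finset.sum_comm]
  simp only [← Finset.mul_sum, (hF _ _).2, mul_one, h.2]

lemma sum_mul_posteriorMap {K : W → A → ℝ} {F : A → W → B → ℝ}
    (hK : ∀ w a, 0 ≤ K w a) (c : κ → W) (a : A) (b : B) :
    (∑ k, K (c k) a) * posteriorMap K F c a b = ∑ k, K (c k) a * F a (c k) b := by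
  simp only [posteriorMap, Finset.mul_sum]
  refine Finset.sum_congr rfl fun k _ => ?_
  rw [← normalize_mul_sum (fun k' => hK (c k') a) k]
  ring

end Posterior

section OneShot

variable {W U X Y V κ ι : Type*} [Fintype W] [Fintype U] [Fintype X] [Fintype Y] [Fintype V]
  [Fintype κ] [Fintype ι]

/-- A joint distribution of the form `P_W P_{U|W} P_{X|UW} P_{Y|X} P_{V|WY}`, given by its factors:
the test channel from which codebooks are drawn. -/
structure TestChannel (W U X Y V : Type*) [Fintype W] [Fintype U] [Fintype X] [Fintype Y]
    [Fintype V] where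
  prior : W → ℝ
  prior_mem : prior ∈ stdSimplex ℝ W
  toU : W → U → ℝ
  toU_mem : ∀ w, toU w ∈ stdSimplex ℝ U
  toX : U → W → X → ℝ
  toX_mem : ∀ u w, toX u w ∈ stdSimplex ℝ X
  toY : X → Y → ℝ
  toY_mem : ∀ x, toY x ∈ stdSimplex ℝ Y
  toV : W → Y → V → ℝ
  toV_mem : ∀ w y, toV w y ∈ stdSimplex ℝ V

namespace TestChannel

variable (T : TestChannel W U X Y V)

/-- The distribution of `U`. -/
def source : U → ℝ := outputLaw T.toU T.prior

/-- The conditional distribution of `Y` given `W`. -/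
def relay (w : W) (y : Y) : ℝ := ∑ u, ∑ x, T.toU w u * T.toX u w x * T.toY x y

/-- The conditional distribution of `(U, X, Y, V)` given `W`. -/
def joint (w : W) (z : U × X × Y × V) : ℝ :=
  T.toU w z.1 * T.toX z.1 w z.2.1 * T.toY z.2.1 z.2.2.1 * T.toV w z.2.2.1 z.2.2.2

/-- The distribution of `(U, X, Y, V)`. -/
def target : U × X × Y × V → ℝ := outputLaw T.joint T.prior

lemma relay_mem (w : W) : T.relay w ∈ stdSimplex ℝ Y := by
  refine ⟨fun y => Finset.sum_nonneg fun u _ => Finset.sum_nonneg fun x _ =>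
    mul_nonneg (mul_nonneg ((T.toU_mem _).1 _) ((T.toX_mem _ _).1 _)) ((T.toY_mem _).1 _), ?_⟩
  simp only [relay, Finset.sum_comm (s := (Finset.univ : Finset Y)), ← Finset.mul_sum,
    (T.toY_mem _).2, (T.toX_mem _ _).2, (T.toU_mem _).2, mul_one]

lemma joint_mem (w : W) : T.joint w ∈ stdSimplex ℝ (U × X × Y × V) := by
  refine ⟨fun z => mul_nonneg (mul_nonneg (mul_nonneg ((T.toU_mem _).1 _) ((T.toX_mem _ _).1 _))
    ((T.toY_mem _).1 _)) ((T.toV_mem _ _).1 _), ?_⟩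
  simp only [joint, Fintype.sum_prod_type, ← Finset.mul_sum, (T.toV_mem _ _).2, (T.toY_mem _).2,
    (T.toX_mem _ _).2, (T.toU_mem _).2, mul_one]

/-- The likelihood encoder of the codebook `c`: it draws a codeword with its posterior probability
given the source output `u`, and passes it with `u` through `toX`. -/
def encoder (c : κ → W) : U → X → ℝ := posteriorMap T.toU T.toX c

/-- The likelihood decoder of the codebook `c`: it draws a codeword with its posterior probability
given the channel output `y`, and passes it with `y` through `toV`. -/
def decoder (c : κ → W) : Y → V → ℝ := posteriorMap T.relay (fun y w => T.toV w y) c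

lemma encoder_mem [Nonempty κ] (c : κ → W) (u : U) : T.encoder c u ∈ stdSimplex ℝ X :=
  posteriorMap_mem (fun w => (T.toU_mem w).1) T.toX_mem c u

lemma decoder_mem [Nonempty κ] (c : κ → W) (y : Y) : T.decoder c y ∈ stdSimplex ℝ V :=
  posteriorMap_mem (fun w => (T.relay_mem w).1) (fun y w => T.toV_mem w y) c y

/-- The distribution of `(U, X, Y, V)` when the likelihood encoder and the likelihood decoder of the
codebook `c` are applied to a source with distribution `Q`. -/
def codedLaw (Q : U → ℝ) (c : κ → W) (z : U × X × Y × V) : ℝ :=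
  Q z.1 * T.encoder c z.1 z.2.1 * T.toY z.2.1 z.2.2.1 * T.decoder c z.2.2.1 z.2.2.2

/-- The distance between the source and the distribution of `U` for a uniformly chosen codeword. -/
def sourceError (c : κ → W) : ℝ := ∑ u, |(∑ k, T.toU (c k) u) / Fintype.card κ - T.source u|

/-- The probability that, after the transmission of a uniformly chosen codeword, the likelihood
decoder draws another index. -/
def decodingError (c : κ → W) : ℝ :=
  (∑ k, ∑ y, T.relay (c k) y * (1 - normalize (fun k' => T.relay (c k') y) k)) / Fintype.card κ

/-- The distance between the target and the distribution of `(U, X, Y, V)` for a uniformly chosen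
codeword. -/
def targetError (c : κ → W) : ℝ := ∑ z, |(∑ k, T.joint (c k) z) / Fintype.card κ - T.target z|

lemma sum_abs_codedLaw_sub [Nonempty κ] (Q Q' : U → ℝ) (c : κ → W) :
    ∑ z, |T.codedLaw Q c z - T.codedLaw Q' c z| = ∑ u, |Q u - Q' u| := by
  have hfactor (z : U × X × Y × V) : |T.codedLaw Q c z - T.codedLaw Q' c z| =
      |Q z.1 - Q' z.1| * T.encoder c z.1 z.2.1 * T.toY z.2.1 z.2.2.1 *
        T.decoder c z.2.2.1 z.2.2.2 := by
    simp only [codedLaw, ← sub_mul, abs_mul, abs_of_nonneg ((T.encoder_mem c _).1 _),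
      abs_of_nonneg ((T.toY_mem _).1 _), abs_of_nonneg ((T.decoder_mem c _).1 _)]
  simp only [hfactor, Fintype.sum_prod_type, ← Finset.mul_sum, (T.decoder_mem c _).2,
    (T.toY_mem _).2, (T.encoder_mem c _).2, mul_one]

lemma codedLaw_average (c : κ → W) (z : U × X × Y × V) :
    T.codedLaw (fun u => (∑ k, T.toU (c k) u) / Fintype.card κ) c z =
      (∑ k, T.toU (c k) z.1 * T.toX z.1 (c k) z.2.1 * T.toY z.2.1 z.2.2.1 *
        T.decoder c z.2.2.1 z.2.2.2) / Fintype.card κ := by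
  simp only [← Finset.sum_mul]
  rw [← sum_mul_posteriorMap fun w => (T.toU_mem w).1]
  simp only [codedLaw, encoder]
  ring

lemma sum_abs_codedLaw_average_sub_le [Nonempty κ] (c : κ → W) :
    ∑ z, |T.codedLaw (fun u => (∑ k, T.toU (c k) u) / Fintype.card κ) c z -
      (∑ k, T.joint (c k) z) / Fintype.card κ| ≤ 2 * T.decodingError c := by
  have htriangle (z : U × X × Y × V) :
      |T.codedLaw (fun u => (∑ k, T.toU (c k) u) / Fintype.card κ) c z -
        (∑ k, T.joint (c k) z) / Fintype.card κ| ≤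
      (∑ k, T.toU (c k) z.1 * T.toX z.1 (c k) z.2.1 * T.toY z.2.1 z.2.2.1 *
        |T.decoder c z.2.2.1 z.2.2.2 - T.toV (c k) z.2.2.1 z.2.2.2|) / Fintype.card κ := by
    rw [codedLaw_average, ← sub_div, ← Finset.sum_sub_distrib, abs_div, Nat.abs_cast]
    gcongr
    refine (Finset.abs_sum_le_sum_abs _ _).trans_eq (Finset.sum_congr rfl fun k _ => ?_)
    simp only [joint, ← mul_sub, abs_mul, abs_of_nonneg ((T.toU_mem _).1 _),
      abs_of_nonneg ((T.toX_mem _ _).1 _), abs_of_nonneg ((T.toY_mem _).1 _)]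
  have hmarginal (k : κ) (F : Y → V → ℝ) :
      ∑ z : U × X × Y × V, T.toU (c k) z.1 * T.toX z.1 (c k) z.2.1 * T.toY z.2.1 z.2.2.1 *
        F z.2.2.1 z.2.2.2 = ∑ y, T.relay (c k) y * ∑ v, F y v := by
    simp only [Fintype.sum_prod_type, relay, ← Finset.mul_sum, Finset.sum_mul]
    simp only [Finset.sum_comm (s := (Finset.univ : Finset Y))]
  refine (Finset.sum_le_sum fun z _ => htriangle z).trans ?_
  rw [← Finset.sum_div, Finset.sum_comm, decodingError, ← mul_div_assoc, Finset.mul_sum]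
  gcongr with k
  rw [hmarginal k fun y v => |T.decoder c y v - T.toV (c k) y v|, Finset.mul_sum]
  refine Finset.sum_le_sum fun y _ => ?_
  rw [mul_left_comm]
  exact mul_le_mul_of_nonneg_left (sum_abs_mixture_sub_le
    (normalize_mem fun k' => (T.relay_mem (c k')).1 y) (fun k' => T.toV_mem (c k') y) k)
    ((T.relay_mem _).1 y)

lemma sum_abs_codedLaw_sub_output_le [Nonempty κ] (c : κ → W) :
    ∑ z, |T.codedLaw T.source c z - (∑ k, T.joint (c k) z) / Fintype.card κ| ≤
      T.sourceError c + 2 * T.decodingError c := by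
  set Q : U → ℝ := fun u => (∑ k, T.toU (c k) u) / Fintype.card κ with hQ
  calc _ ≤ ∑ z, (|T.codedLaw T.source c z - T.codedLaw Q c z| +
        |T.codedLaw Q c z - (∑ k, T.joint (c k) z) / Fintype.card κ|) :=
        Finset.sum_le_sum fun z _ => abs_sub_le _ _ _
    _ ≤ T.sourceError c + 2 * T.decodingError c := by
        rw [Finset.sum_add_distrib, sum_abs_codedLaw_sub]
        refine add_le_add (le_of_eq ?_) (T.sum_abs_codedLaw_average_sub_le c)
        simp only [sourceError, hQ, abs_sub_comm]

/-- The `L¹` distance between the target and the distribution that the codes of the rows of the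
codebook `c` induce when the row is chosen uniformly. -/
def codingError (c : ι → κ → W) : ℝ :=
  ∑ z, |(∑ i, T.codedLaw T.source (c i) z) / Fintype.card ι - T.target z|

lemma codingError_le [Nonempty κ] (c : ι → κ → W) :
    T.codingError c ≤ (∑ i, (T.sourceError (c i) + 2 * T.decodingError (c i))) / Fintype.card ι +
      T.targetError (Function.uncurry c) := by
  have htriangle (z : U × X × Y × V) :
      |(∑ i, T.codedLaw T.source (c i) z) / Fintype.card ι - T.target z| ≤
      (∑ i, |T.codedLaw T.source (c i) z - (∑ k, T.joint (c i k) z) / Fintype.card κ|) /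
        Fintype.card ι +
      |(∑ j, T.joint (Function.uncurry c j) z) / Fintype.card (ι × κ) - T.target z| := by
    have hrows : (∑ j, T.joint (Function.uncurry c j) z) / Fintype.card (ι × κ) =
        (∑ i, (∑ k, T.joint (c i k) z) / Fintype.card κ) / Fintype.card ι := by
      rw [Fintype.sum_prod_type, ← Finset.sum_div, div_div, Fintype.card_prod, Nat.cast_mul,
        mul_comm (Fintype.card ι : ℝ)]
      rfl
    refine (abs_sub_le _ _ _).trans (add_le_add ?_ le_rfl)
    rw [hrows, ← sub_div, ← Finset.sum_sub_distrib, abs_div, Nat.abs_cast]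
    gcongr
    exact Finset.abs_sum_le_sum_abs _ _
  refine (Finset.sum_le_sum fun z _ => htriangle z).trans ?_
  rw [Finset.sum_add_distrib, ← Finset.sum_div, Finset.sum_comm]
  refine add_le_add ?_ le_rfl
  gcongr with i
  exact T.sum_abs_codedLaw_sub_output_le (c i)

lemma mean_decodingError_le [DecidableEq κ] [Nonempty κ] {θ : ℝ} (hθ : 0 < θ) :
    mean (powLaw T.prior) (fun c : κ → W => T.decodingError c) ≤
      densityLowerTail T.prior T.relay θ + Fintype.card κ / θ := by
  simp only [decodingError]
  rw [mean_div_const, mean_sum, div_le_iff₀' (by positivity), ← nsmul_eq_mul]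
  exact Finset.sum_le_card_nsmul _ _ _ fun k _ =>
    mean_likelihoodDecoder_le T.prior_mem T.relay_mem k hθ

lemma exists_codingError_le [Nonempty ι] [Nonempty κ]
    {θ₁ θ₂ θ₃ : ℝ} (h₁ : 0 ≤ θ₁) (h₂ : 0 < θ₂) (h₃ : 0 ≤ θ₃) :
    ∃ c : ι → κ → W, T.codingError c ≤
      (√(θ₁ / Fintype.card κ) + 2 * densityUpperTail T.prior T.toU θ₁) +
      2 * (densityLowerTail T.prior T.relay θ₂ + Fintype.card κ / θ₂) +
      (√(θ₃ / Fintype.card (ι × κ)) + 2 * densityUpperTail T.prior T.joint θ₃) := by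
  classical
  have hrow : powLaw T.prior ∈ stdSimplex ℝ (κ → W) := prodLaw_mem fun _ => T.prior_mem
  refine exists_le_of_mean_le (prodLaw_mem fun _ => hrow) ?_
  refine (mean_mono (prodLaw_mem fun _ => hrow).1 T.codingError_le).trans ?_
  rw [mean_add, mean_powLaw_average hrow fun c => T.sourceError c + 2 * T.decodingError c,
    mean_add, mean_const_mul, mean_powLaw_curry]
  gcongr
  · exact mean_softCovering_le T.prior_mem T.toU_mem h₁
  · exact T.mean_decodingError_le h₂
  · exact mean_softCovering_le T.prior_mem T.joint_mem h₃

end TestChannel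

end OneShot

/-! ### Deviations of i.i.d. sums -/

section Deviation

variable {Ω : Type*} [Fintype Ω]

lemma exists_mean_exp_le {P : Ω → ℝ} (hP : P ∈ stdSimplex ℝ Ω) (f : Ω → ℝ) :
    ∃ c : ℝ, 0 ≤ c ∧
      ∀ t, mean P (fun ω => Real.exp (t * (f ω - mean P f))) ≤ Real.exp (c * t ^ 2 / 2) := by
  let _ : MeasurableSpace Ω := ⊤
  let μ : MeasureTheory.Measure Ω :=
    ∑ ω, ENNReal.ofReal (P ω) • MeasureTheory.Measure.dirac ω
  have hμ : MeasureTheory.IsProbabilityMeasure μ := ⟨by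
    simp [μ, ← ENNReal.ofReal_sum_of_nonneg fun ω _ => hP.1 ω, hP.2]⟩
  have hmean (F : Ω → ℝ) : ∫ ω, F ω ∂μ = mean P F := by
    rw [MeasureTheory.integral_finsetSum_measure fun ω _ =>
      (MeasureTheory.integrable_dirac (by finiteness)).smul_measure ENNReal.ofReal_ne_top]
    simp [MeasureTheory.integral_smul_measure, ENNReal.toReal_ofReal (hP.1 _), mean]
  obtain ⟨a, ha⟩ := (Set.finite_range f).bddBelow
  obtain ⟨b, hb⟩ := (Set.finite_range f).bddAbove
  have hoeffding := ProbabilityTheory.hasSubgaussianMGF_of_mem_Icc (μ := μ) (X := f) (a := a)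
    (b := b) (Measurable.of_discrete.aemeasurable)
    (.of_forall fun ω => ⟨ha ⟨ω, rfl⟩, hb ⟨ω, rfl⟩⟩)
  refine ⟨((‖b - a‖₊ / 2) ^ 2 : NNReal), NNReal.coe_nonneg _, fun t => ?_⟩
  have := hoeffding.mgf_le t
  rwa [ProbabilityTheory.mgf, hmean, hmean] at this

/-- The deviation scale `√(ln n / n)` of the average of `n` i.i.d. random variables. -/
def devScale (n : ℕ) : ℝ := √(Real.log n / n)

lemma devScale_nonneg (n : ℕ) : 0 ≤ devScale n := Real.sqrt_nonneg _

lemma mul_devScale_sq {n : ℕ} (hn : 1 ≤ n) : n * devScale n ^ 2 = Real.log n := by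
  have hn' : (0 : ℝ) < n := by exact_mod_cast hn
  rw [devScale, Real.sq_sqrt (div_nonneg (Real.log_natCast_nonneg n) hn'.le),
    mul_div_cancel₀ _ hn'.ne']

lemma exists_prob_sum_ge_le {P : Ω → ℝ} (hP : P ∈ stdSimplex ℝ Ω) (f : Ω → ℝ) :
    ∃ g : ℝ, 0 < g ∧ ∀ n : ℕ, 1 ≤ n →
      prob (powLaw P) {c : Fin n → Ω | n * (mean P f + g * devScale n) ≤ ∑ i, f (c i)} ≤
        1 / n := by
  obtain ⟨c, hc, hexp⟩ := exists_mean_exp_le hP f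
  refine ⟨1 + c / 2, by positivity, fun n hn => ?_⟩
  have hn' : (0 : ℝ) < n := by exact_mod_cast hn
  have hδ := mul_devScale_sq hn
  set δ := devScale n
  have hmoment : mean (powLaw P)
      (fun ω : Fin n → Ω => Real.exp (δ * ∑ i, (f (ω i) - mean P f))) ≤
      Real.exp (c / 2 * Real.log n) := by
    simp only [Finset.mul_sum, Real.exp_sum]
    rw [mean_prodLaw_prod (fun _ => P) fun _ ω => Real.exp (δ * (f ω - mean P f)),
      Finset.prod_const, Finset.card_univ, Fintype.card_fin]
    calc _ ≤ Real.exp (c * δ ^ 2 / 2) ^ n := by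
          gcongr
          · exact mean_nonneg hP.1 fun ω => (Real.exp_pos _).le
          · exact hexp δ
      _ = Real.exp (c / 2 * Real.log n) := by
          rw [← Real.exp_nat_mul, ← hδ]; ring_nf
  have hmarkov := mul_prob_le_mean (prodLaw_mem fun _ : Fin n => hP).1
    (fun ω : Fin n → Ω => (Real.exp_pos (δ * ∑ i, (f (ω i) - mean P f))).le)
    (s := {ω | n * (mean P f + (1 + c / 2) * δ) ≤ ∑ i, f (ω i)})
    (a := Real.exp ((1 + c / 2) * Real.log n)) fun ω hω => by
      refine Real.exp_le_exp.2 ?_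
      rw [Finset.sum_sub_distrib, Finset.sum_const, Finset.card_univ, Fintype.card_fin,
        nsmul_eq_mul, ← hδ]
      have hdev : n * (mean P f + (1 + c / 2) * δ) ≤ ∑ i, f (ω i) := hω
      linarith [mul_le_mul_of_nonneg_left hdev (devScale_nonneg n)]
  rw [le_div_iff₀' hn']
  refine le_of_mul_le_mul_left ?_ (Real.exp_pos (c / 2 * Real.log n))
  have hexp_add :
      Real.exp ((1 + c / 2) * Real.log n) = Real.exp (c / 2 * Real.log n) * n := by
    rw [add_mul, Real.exp_add, one_mul, Real.exp_log hn', mul_comm]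
  rw [mul_one, ← mul_assoc, ← hexp_add]
  exact hmarkov.trans hmoment

lemma exists_prob_sum_le_le {P : Ω → ℝ} (hP : P ∈ stdSimplex ℝ Ω) (f : Ω → ℝ) :
    ∃ g : ℝ, 0 < g ∧ ∀ n : ℕ, 1 ≤ n →
      prob (powLaw P) {c : Fin n → Ω | ∑ i, f (c i) ≤ n * (mean P f - g * devScale n)} ≤
        1 / n := by
  obtain ⟨g, hg, h⟩ := exists_prob_sum_ge_le hP fun ω => -1 * f ω
  refine ⟨g, hg, fun n hn => (prob_mono (prodLaw_mem fun _ => hP).1 fun c _ hc => ?_).trans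
    (h n hn)⟩
  simp only [Set.mem_ofPred_eq, mean_const_mul, ← Finset.mul_sum] at hc ⊢
  linarith

end Deviation

/-! ### Product channels -/

section Product

variable {ι W Z : Type*} [Fintype ι] [DecidableEq ι] [Fintype W]

/-- The memoryless channel with transition probabilities `K`. -/
def powKernel {ι W Z : Type*} [Fintype ι] (K : W → Z → ℝ) (w : ι → W) : (ι → Z) → ℝ :=
  prodLaw fun i => K (w i)

lemma outputLaw_powKernel (K : W → Z → ℝ) (p : W → ℝ) :
    outputLaw (powKernel K) (powLaw p : (ι → W) → ℝ) = powLaw (outputLaw K p) :=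
  funext fun z => mean_prodLaw_prod (fun _ => p) fun i w => K w (z i)

variable [Fintype Z]

lemma mean_jointLaw_infoDensity (p : W → ℝ) (K : W → Z → ℝ) :
    mean (jointLaw p K) (fun ω => infoDensity K p ω.1 ω.2) = channelInfo K p :=
  mean_jointLaw p K _

lemma prob_jointLaw_powKernel_le {p : W → ℝ} (hp : p ∈ stdSimplex ℝ W) {K : W → Z → ℝ}
    (hK : ∀ w, K w ∈ stdSimplex ℝ Z) {s : Set ((ι → W) × (ι → Z))} {t : Set (ι → W × Z)}
    (h : ∀ w z, (∀ i, 0 < p (w i)) → (∀ i, 0 < K (w i) (z i)) → (w, z) ∈ s →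
      (fun i => (w i, z i)) ∈ t) :
    prob (jointLaw (powLaw p) (powKernel K)) s ≤ prob (powLaw (jointLaw p K)) t := by
  have hreindex : prob (powLaw (jointLaw p K)) t =
      prob (jointLaw (powLaw p) (powKernel K)) {ω | (fun i => (ω.1 i, ω.2 i)) ∈ t} := by
    rw [prob, ← (Equiv.arrowProdEquivProdArrow ι (fun _ => W) fun _ => Z).symm.sum_comp]
    refine Finset.sum_congr rfl fun ω _ => ?_
    have hfactor : powLaw (jointLaw p K) (fun i => (ω.1 i, ω.2 i)) =
        jointLaw (powLaw p) (powKernel K) ω := Finset.prod_mul_distrib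
    classical
    simp only [Set.indicator_apply, ← hfactor]
    rfl
  rw [hreindex]
  refine prob_mono (jointLaw_mem (prodLaw_mem fun _ => hp) fun w => prodLaw_mem fun i =>
    hK (w i)).1 fun ω hω hs => h ω.1 ω.2 (fun i => ?_) (fun i => ?_) hs
  · exact (hp.1 _).lt_of_ne' (Finset.prod_ne_zero_iff.1 (left_ne_zero_of_mul hω) i
      (Finset.mem_univ i))
  · exact ((hK _).1 _).lt_of_ne' (Finset.prod_ne_zero_iff.1 (right_ne_zero_of_mul hω) i
      (Finset.mem_univ i))

lemma prob_jointLaw_powKernel_le_one {p : W → ℝ} (hp : p ∈ stdSimplex ℝ W) {K : W → Z → ℝ}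
    (hK : ∀ w, K w ∈ stdSimplex ℝ Z) (s : Set ((ι → W) × (ι → Z))) :
    prob (jointLaw (powLaw p) (powKernel K)) s ≤ 1 :=
  prob_le_one (jointLaw_mem (prodLaw_mem fun _ => hp) fun w => prodLaw_mem fun i => hK (w i)) s

lemma logb_powKernel_div_outputLaw {p : W → ℝ} (hp : p ∈ stdSimplex ℝ W) {K : W → Z → ℝ}
    (hK : ∀ w, K w ∈ stdSimplex ℝ Z) {w : ι → W} {z : ι → Z} (hw : ∀ i, 0 < p (w i))
    (hz : ∀ i, 0 < K (w i) (z i)) :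
    0 < powKernel K w z ∧ 0 < outputLaw (powKernel K) (powLaw p) z ∧
      Real.logb 2 (powKernel K w z / outputLaw (powKernel K) (powLaw p) z) =
        ∑ i, infoDensity K p (w i) (z i) := by
  have hq (i : ι) : 0 < outputLaw K p (z i) :=
    (mul_pos (hw i) (hz i)).trans_le (Finset.single_le_sum (f := fun w => p w * K w (z i))
      (fun w _ => mul_nonneg (hp.1 w) ((hK w).1 _)) (Finset.mem_univ (w i)))
  rw [outputLaw_powKernel]
  refine ⟨Finset.prod_pos fun i _ => hz i, Finset.prod_pos fun i _ => hq i, ?_⟩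
  simp only [powKernel, prodLaw]
  rw [← Finset.prod_div_distrib, Real.logb_prod _ _ fun i _ => (div_pos (hz i) (hq i)).ne']
  rfl

lemma densityUpperTail_powKernel_le {p : W → ℝ} (hp : p ∈ stdSimplex ℝ W) {K : W → Z → ℝ}
    (hK : ∀ w, K w ∈ stdSimplex ℝ Z) {θ : ℝ} (hθ : 0 < θ) :
    densityUpperTail (powLaw p) (powKernel K : (ι → W) → _) θ ≤ prob (powLaw (jointLaw p K))
      {c : ι → W × Z | Real.logb 2 θ ≤ ∑ i, infoDensity K p (c i).1 (c i).2} := by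
  refine prob_jointLaw_powKernel_le hp hK fun w z hw hz hs => ?_
  obtain ⟨-, hq, hlog⟩ := logb_powKernel_div_outputLaw hp hK hw hz
  rw [Set.mem_ofPred_eq, ← hlog]
  exact Real.logb_le_logb_of_le one_lt_two hθ ((le_div_iff₀ hq).2 (le_of_lt hs))

lemma densityLowerTail_powKernel_le {p : W → ℝ} (hp : p ∈ stdSimplex ℝ W) {K : W → Z → ℝ}
    (hK : ∀ w, K w ∈ stdSimplex ℝ Z) (θ : ℝ) :
    densityLowerTail (powLaw p) (powKernel K : (ι → W) → _) θ ≤ prob (powLaw (jointLaw p K))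
      {c : ι → W × Z | ∑ i, infoDensity K p (c i).1 (c i).2 ≤ Real.logb 2 θ} := by
  refine prob_jointLaw_powKernel_le hp hK fun w z hw hz hs => ?_
  obtain ⟨hpos, hq, hlog⟩ := logb_powKernel_div_outputLaw hp hK hw hz
  rw [Set.mem_ofPred_eq, ← hlog]
  exact Real.logb_le_logb_of_le one_lt_two (div_pos hpos hq) ((div_le_iff₀ hq).2 hs)

lemma exists_densityUpperTail_le {p : W → ℝ} (hp : p ∈ stdSimplex ℝ W) {K : W → Z → ℝ}
    (hK : ∀ w, K w ∈ stdSimplex ℝ Z) :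
    ∃ g : ℝ, 0 < g ∧ ∀ n : ℕ, 1 ≤ n → ∀ θ : ℝ, 0 < θ →
      n * (channelInfo K p + g * devScale n) ≤ Real.logb 2 θ →
      densityUpperTail (powLaw p) (powKernel K : (Fin n → W) → _) θ ≤ 1 / n := by
  obtain ⟨g, hg, hdev⟩ := exists_prob_sum_ge_le (jointLaw_mem hp hK)
    fun ω => infoDensity K p ω.1 ω.2
  rw [mean_jointLaw_infoDensity] at hdev
  refine ⟨g, hg, fun n hn θ hθ hlog => (densityUpperTail_powKernel_le hp hK hθ).trans
    (le_trans (prob_mono (prodLaw_mem fun _ => jointLaw_mem hp hK).1 fun c _ hc => ?_)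
      (hdev n hn))⟩
  exact hlog.trans hc

lemma exists_densityLowerTail_le {p : W → ℝ} (hp : p ∈ stdSimplex ℝ W) {K : W → Z → ℝ}
    (hK : ∀ w, K w ∈ stdSimplex ℝ Z) :
    ∃ g : ℝ, 0 < g ∧ ∀ n : ℕ, 1 ≤ n → ∀ θ : ℝ,
      Real.logb 2 θ ≤ n * (channelInfo K p - g * devScale n) →
      densityLowerTail (powLaw p) (powKernel K : (Fin n → W) → _) θ ≤ 1 / n := by
  obtain ⟨g, hg, hdev⟩ := exists_prob_sum_le_le (jointLaw_mem hp hK)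
    fun ω => infoDensity K p ω.1 ω.2
  rw [mean_jointLaw_infoDensity] at hdev
  refine ⟨g, hg, fun n hn θ hlog => (densityLowerTail_powKernel_le hp hK θ).trans
    (le_trans (prob_mono (prodLaw_mem fun _ => jointLaw_mem hp hK).1 fun c _ hc => ?_)
      (hdev n hn))⟩
  exact le_trans hc hlog

end Product

section ProductTestChannel

variable {ι W U X Y V : Type*} [Fintype ι] [DecidableEq ι] [Fintype W] [Fintype U] [Fintype X]
  [Fintype Y] [Fintype V]

/-- Splits a sequence of quadruples into four sequences. -/
def zipEquiv {ι U X Y V : Type*} :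
    (ι → U) × (ι → X) × (ι → Y) × (ι → V) ≃ (ι → U × X × Y × V) where
  toFun z i := (z.1 i, z.2.1 i, z.2.2.1 i, z.2.2.2 i)
  invFun c := (fun i => (c i).1, fun i => (c i).2.1, fun i => (c i).2.2.1, fun i => (c i).2.2.2)

namespace TestChannel

variable (T : TestChannel W U X Y V)

/-- Independent copies of a test channel, indexed by `ι`. -/
def pow (ι : Type*) [Fintype ι] [DecidableEq ι] :
    TestChannel (ι → W) (ι → U) (ι → X) (ι → Y) (ι → V) where
  prior := powLaw T.prior
  prior_mem := prodLaw_mem fun _ => T.prior_mem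
  toU := powKernel T.toU
  toU_mem w := prodLaw_mem fun i => T.toU_mem (w i)
  toX u w := prodLaw fun i => T.toX (u i) (w i)
  toX_mem u w := prodLaw_mem fun i => T.toX_mem (u i) (w i)
  toY := powKernel T.toY
  toY_mem x := prodLaw_mem fun i => T.toY_mem (x i)
  toV w y := prodLaw fun i => T.toV (w i) (y i)
  toV_mem w y := prodLaw_mem fun i => T.toV_mem (w i) (y i)

lemma source_pow : (T.pow ι).source = powLaw T.source := outputLaw_powKernel T.toU T.prior

lemma relay_pow : (T.pow ι).relay = powKernel T.relay := by
  funext w y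
  simp only [relay, pow, powKernel, prodLaw, Fintype.prod_sum, Finset.prod_mul_distrib]

lemma joint_pow (w : ι → W) : (T.pow ι).joint w = powKernel T.joint w ∘ zipEquiv := by
  funext z
  simp only [joint, pow, powKernel, prodLaw, zipEquiv, Function.comp_apply, Equiv.coe_fn_mk,
    Finset.prod_mul_distrib]

lemma target_pow : (T.pow ι).target = powLaw T.target ∘ zipEquiv := by
  funext z
  change mean (powLaw T.prior) (fun w => (T.pow ι).joint w z) = _
  simp only [joint_pow]
  exact congrFun (outputLaw_powKernel T.joint T.prior) (zipEquiv z)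

lemma densityUpperTail_joint_pow (θ : ℝ) :
    densityUpperTail (T.pow ι).prior (T.pow ι).joint θ =
      densityUpperTail (powLaw T.prior) (powKernel T.joint : (ι → W) → _) θ := by
  rw [densityUpperTail, prob, ← ((Equiv.refl (ι → W)).prodCongr zipEquiv.symm).sum_comp]
  refine Finset.sum_congr rfl fun ω _ => ?_
  have hprior : (T.pow ι).prior = powLaw T.prior := rfl
  simp [Set.indicator_apply, jointLaw, outputLaw, joint_pow, hprior]

end TestChannel

end ProductTestChannel

/-! ### Laws and information measures -/

section Law

variable {Ω Ω' α β γ : Type*} [Fintype Ω] [Fintype Ω']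

lemma law_comp_equiv (e : Ω ≃ Ω') (p : Ω' → ℝ) (A : Ω' → α) :
    law (p ∘ e) (fun ω => A (e ω)) = law p A :=
  funext fun a => by
    classical exact e.sum_comp fun ω => if A ω = a then p ω else 0

lemma law_comp_injective {f : α → β} (hf : f.Injective) (p : Ω → ℝ) (A : Ω → α) (a : α) :
    law p (fun ω => f (A ω)) (f a) = law p A a := by
  classical exact Finset.sum_congr rfl fun _ _ => if_congr hf.eq_iff rfl rfl

lemma law_id (p : Ω → ℝ) : law p (fun ω => ω) = p := by
  classical
  funext a
  simp [law]

lemma law_mono {p : Ω → ℝ} (hp : ∀ ω, 0 ≤ p ω) {A : Ω → α} {B : Ω → β} {a : α} {b : β}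
    (h : ∀ ω, A ω = a → B ω = b) : law p A a ≤ law p B b := by
  refine Finset.sum_le_sum fun ω _ => ?_
  by_cases hA : A ω = a
  · rw [if_pos hA, if_pos (h ω hA)]
  · rw [if_neg hA]
    split_ifs
    exacts [hp ω, le_rfl]

lemma law_pos {p : Ω → ℝ} (hp : ∀ ω, 0 ≤ p ω) (A : Ω → α) {ω : Ω} (hω : p ω ≠ 0) :
    0 < law p A (A ω) := by
  classical
  calc 0 < p ω := (hp ω).lt_of_ne' hω
    _ = law p (fun ω => ω) ω := by rw [law_id]
    _ ≤ law p A (A ω) := law_mono hp fun _ h => congrArg A h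

lemma exists_eq_of_law_ne_zero {p : Ω → ℝ} {A : Ω → α} {a : α} (h : law p A a ≠ 0) :
    ∃ ω, p ω ≠ 0 ∧ A ω = a := by
  classical
  obtain ⟨ω, -, hω⟩ := Finset.exists_ne_zero_of_sum_ne_zero h
  obtain ⟨hA, hp⟩ := ite_ne_right_iff.1 hω
  exact ⟨ω, hp, hA⟩

lemma mean_law [Fintype α] (p : Ω → ℝ) (A : Ω → α) (f : α → ℝ) :
    mean (law p A) f = mean p (fun ω => f (A ω)) := by
  classical
  simp only [mean, law, Finset.sum_mul, ite_mul, zero_mul]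
  rw [Finset.sum_comm]
  simp

lemma law_mem [Fintype α] {p : Ω → ℝ} (hp : p ∈ stdSimplex ℝ Ω) (A : Ω → α) :
    law p A ∈ stdSimplex ℝ α :=
  ⟨fun _ => Finset.sum_nonneg fun ω _ => by split_ifs; exacts [hp.1 ω, le_rfl], by
    simpa [mean, hp.2] using mean_law p A fun _ => 1⟩

lemma sum_law_prodMk_left [Fintype α] (p : Ω → ℝ) (A : Ω → α) (B : Ω → β) (b : β) :
    ∑ a, law p (fun ω => (A ω, B ω)) (a, b) = law p B b := by
  classical
  simp only [law]
  rw [Finset.sum_comm]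
  refine Finset.sum_congr rfl fun ω _ => ?_
  by_cases h : B ω = b <;> simp [h]

end Law

section Entropy

variable {Ω Ω' α β γ : Type*} [Fintype Ω] [Fintype Ω'] [Fintype α] [Fintype β] [Fintype γ]

lemma entropy_eq_mean (p : Ω → ℝ) (A : Ω → α) :
    entropy p A = mean p (fun ω => -Real.logb 2 (law p A (A ω))) := by
  rw [← mean_law p A fun a => -Real.logb 2 (law p A a)]
  refine Finset.sum_congr rfl fun a _ => ?_
  simp only [Real.negMulLog, Real.logb]
  ring

lemma entropy_nonneg {p : Ω → ℝ} (hp : p ∈ stdSimplex ℝ Ω) (A : Ω → α) : 0 ≤ entropy p A := by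
  rw [entropy_eq_mean]
  have h := law_mem hp A
  exact mean_nonneg hp.1 fun ω => neg_nonneg.2 <|
    Real.logb_nonpos one_lt_two (h.1 _) (le_one_of_mem_stdSimplex h _)

lemma condEntropy_nonneg {p : Ω → ℝ} (hp : ∀ ω, 0 ≤ p ω) (A : Ω → α) (B : Ω → β) :
    0 ≤ condEntropy p A B := by
  rw [condEntropy, entropy_eq_mean, entropy_eq_mean, ← mean_sub]
  refine Finset.sum_nonneg fun ω _ => ?_
  rcases eq_or_ne (p ω) 0 with hω | hω
  · rw [hω, zero_mul]
  · refine mul_nonneg (hp ω) (sub_nonneg.2 (neg_le_neg ?_))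
    exact Real.logb_le_logb_of_le one_lt_two (law_pos hp (fun ω => (A ω, B ω)) hω)
      (law_mono hp fun _ h => congrArg Prod.snd h)

lemma mutualInfo_le_entropy {p : Ω → ℝ} (hp : ∀ ω, 0 ≤ p ω) (A : Ω → α) (B : Ω → β) :
    mutualInfo p A B ≤ entropy p A :=
  sub_le_self _ (condEntropy_nonneg hp A B)

lemma entropy_comp_injective {f : α → β} (hf : f.Injective) (p : Ω → ℝ) (A : Ω → α) :
    entropy p (fun ω => f (A ω)) = entropy p A := by
  rw [entropy_eq_mean, entropy_eq_mean]
  simp only [law_comp_injective hf]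

lemma mutualInfo_comp_injective_right {f : β → γ} (hf : f.Injective) (p : Ω → ℝ) (A : Ω → α)
    (B : Ω → β) : mutualInfo p A (fun ω => f (B ω)) = mutualInfo p A B := by
  have hpair := entropy_comp_injective (Function.injective_id.prodMap hf) p fun ω => (A ω, B ω)
  simp only [Prod.map_apply, id] at hpair
  rw [mutualInfo, mutualInfo, condEntropy, condEntropy, hpair, entropy_comp_injective hf]

lemma mutualInfo_comp_equiv (e : Ω ≃ Ω') (p : Ω' → ℝ) (A : Ω' → α) (B : Ω' → β) :
    mutualInfo (p ∘ e) (fun ω => A (e ω)) (fun ω => B (e ω)) = mutualInfo p A B := by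
  have hpair := law_comp_equiv e p fun ω => (A ω, B ω)
  simp only [mutualInfo, condEntropy, entropy, law_comp_equiv e p A, law_comp_equiv e p B, hpair]

lemma condMutualInfo_add_mutualInfo (p : Ω → ℝ) (A : Ω → α) (B : Ω → β) (C : Ω → γ) :
    condMutualInfo p A B C + mutualInfo p A C = mutualInfo p A (fun ω => (B ω, C ω)) := by
  rw [condMutualInfo, mutualInfo, mutualInfo]
  ring

lemma mean_logb_div_nonneg {P Q : Ω → ℝ} (hP : P ∈ stdSimplex ℝ Ω) (hQ : ∀ ω, 0 ≤ Q ω)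
    (hQ_pos : ∀ ω, P ω ≠ 0 → 0 < Q ω) (hQ_sum : ∑ ω, Q ω ≤ 1) :
    0 ≤ mean P (fun ω => Real.logb 2 (P ω / Q ω)) := by
  have hlog (ω : Ω) : P ω - Q ω ≤ P ω * Real.log (P ω / Q ω) := by
    rcases (hP.1 ω).eq_or_lt' with hω | hω
    · simpa [hω] using hQ ω
    · have h := mul_le_mul_of_nonneg_left
        (Real.one_sub_inv_le_log_of_pos (div_pos hω (hQ_pos ω hω.ne'))) hω.le
      rwa [inv_div, mul_sub, mul_one, mul_div_cancel₀ _ hω.ne'] at h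
  simp only [Real.logb]
  rw [mean_div_const]
  refine div_nonneg ?_ (Real.log_pos one_lt_two).le
  have hsum := Finset.sum_le_sum fun ω (_ : ω ∈ Finset.univ) => hlog ω
  rw [Finset.sum_sub_distrib, hP.2] at hsum
  exact (sub_nonneg.2 hQ_sum).trans hsum

lemma condMutualInfo_nonneg {p : Ω → ℝ} (hp : p ∈ stdSimplex ℝ Ω) (A : Ω → α) (B : Ω → β)
    (C : Ω → γ) : 0 ≤ condMutualInfo p A B C := by
  set AC := law p fun ω => (A ω, C ω) with hAC
  set BC := law p fun ω => (B ω, C ω) with hBC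
  have hAC_mem : AC ∈ stdSimplex ℝ (α × γ) := law_mem hp _
  have hBC_mem : BC ∈ stdSimplex ℝ (β × γ) := law_mem hp _
  have hC := law_mem hp C
  set markov : α × β × γ → ℝ := fun z => AC (z.1, z.2.2) * BC z.2 / law p C z.2.2 with hmarkov
  have hsum : ∑ z, markov z ≤ 1 := by
    simp only [hmarkov, Fintype.sum_prod_type, Finset.sum_comm (s := (Finset.univ : Finset α)),
      ← Finset.sum_div, ← Finset.sum_mul, hAC, sum_law_prodMk_left]
    rw [Finset.sum_comm]
    simp only [← Finset.sum_div, ← Finset.mul_sum, hBC, sum_law_prodMk_left, mul_self_div_self]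
    exact hC.2.le
  have hpos {ω : Ω} (hω : p ω ≠ 0) :
      0 < AC (A ω, C ω) ∧ 0 < BC (B ω, C ω) ∧ 0 < law p C (C ω) :=
    ⟨law_pos hp.1 _ hω, law_pos hp.1 _ hω, law_pos hp.1 _ hω⟩
  have hgibbs := mean_logb_div_nonneg (Q := markov) (law_mem hp fun ω => (A ω, B ω, C ω))
    (fun z => div_nonneg (mul_nonneg (hAC_mem.1 _) (hBC_mem.1 _)) (hC.1 _)) (fun z hz => ?_) hsum
  · rw [mean_law] at hgibbs
    refine hgibbs.trans_eq ?_
    simp only [condMutualInfo, condEntropy, entropy_eq_mean, ← mean_sub]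
    refine mean_congr fun ω hω => ?_
    obtain ⟨h₁, h₂, h₃⟩ := hpos hω
    rw [Real.logb_div (law_pos hp.1 _ hω).ne' (div_pos (mul_pos h₁ h₂) h₃).ne',
      Real.logb_div (mul_pos h₁ h₂).ne' h₃.ne', Real.logb_mul h₁.ne' h₂.ne']
    ring
  · obtain ⟨ω, hω, rfl⟩ := exists_eq_of_law_ne_zero hz
    obtain ⟨h₁, h₂, h₃⟩ := hpos hω
    exact div_pos (mul_pos h₁ h₂) h₃

lemma mutualInfo_nonneg {p : Ω → ℝ} (hp : p ∈ stdSimplex ℝ Ω) (A : Ω → α) (B : Ω → β) :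
    0 ≤ mutualInfo p A B := by
  have hchain := condMutualInfo_add_mutualInfo p A B fun _ => ()
  have hpair : mutualInfo p A (fun ω => (B ω, ())) = mutualInfo p A B :=
    mutualInfo_comp_injective_right (f := fun b => (b, ())) (fun _ _ h => congrArg Prod.fst h) p A B
  have hunit : mutualInfo p A (fun _ => ()) = 0 := by
    rw [mutualInfo, condEntropy, entropy_comp_injective (f := fun a => (a, ()))
      (fun _ _ h => congrArg Prod.fst h) p A]
    simp [entropy, law, hp.2]
  rw [hpair, hunit, add_zero] at hchain
  exact hchain ▸ condMutualInfo_nonneg hp A B _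

end Entropy

section ChannelInformation

variable {W Z γ : Type*} [Fintype W] [Fintype Z]

lemma law_jointLaw_prodMk (p : W → ℝ) (K : W → Z → ℝ) (f : Z → γ) (w : W) (c : γ) :
    law (jointLaw p K) (fun ω => (ω.1, f ω.2)) (w, c) = p w * law (K w) f c := by
  classical
  simp only [law, jointLaw, Fintype.sum_prod_type, Prod.mk.injEq, Finset.mul_sum]
  rw [Finset.sum_eq_single w (fun w' _ hw => by simp [hw]) (by simp)]
  exact Finset.sum_congr rfl fun z _ => by by_cases h : f z = c <;> simp [h]

lemma law_jointLaw_fst (p : W → ℝ) {K : W → Z → ℝ} (hK : ∀ w, K w ∈ stdSimplex ℝ Z) :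
    law (jointLaw p K) Prod.fst = p := by
  classical
  funext w
  simp only [law, jointLaw, Fintype.sum_prod_type]
  rw [Finset.sum_eq_single w (fun w' _ hw => by simp [hw]) (by simp)]
  simp [← Finset.mul_sum, (hK w).2]

lemma law_jointLaw_snd (p : W → ℝ) (K : W → Z → ℝ) (f : Z → γ) :
    law (jointLaw p K) (fun ω => f ω.2) = outputLaw (fun w => law (K w) f) p := by
  funext c
  rw [← sum_law_prodMk_left _ Prod.fst]
  exact Finset.sum_congr rfl fun w _ => law_jointLaw_prodMk p K f w c

lemma mutualInfo_jointLaw [Fintype γ] {p : W → ℝ} (hp : p ∈ stdSimplex ℝ W) {K : W → Z → ℝ}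
    (hK : ∀ w, K w ∈ stdSimplex ℝ Z) (f : Z → γ) :
    mutualInfo (jointLaw p K) Prod.fst (fun ω => f ω.2) =
      channelInfo (fun w => law (K w) f) p := by
  have hP := (jointLaw_mem hp hK).1
  have hinfo : channelInfo (fun w => law (K w) f) p =
      mean (jointLaw p K) (fun ω => infoDensity (fun w => law (K w) f) p ω.1 (f ω.2)) := by
    rw [mean_jointLaw]
    exact Finset.sum_congr rfl fun w _ => congrArg (p w * ·) (mean_law (K w) f _)
  rw [hinfo, mutualInfo, condEntropy, entropy_eq_mean, entropy_eq_mean, entropy_eq_mean,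
    ← mean_sub, ← mean_sub]
  refine mean_congr fun ω hω => ?_
  have hfst := law_pos hP Prod.fst hω
  have hsnd := law_pos hP (fun ω => f ω.2) hω
  have hpair := law_pos hP (fun ω => (ω.1, f ω.2)) hω
  rw [law_jointLaw_fst p hK] at hfst ⊢
  rw [law_jointLaw_snd] at hsnd ⊢
  rw [law_jointLaw_prodMk] at hpair ⊢
  have hcond := pos_of_mul_pos_right hpair hfst.le
  rw [Real.logb_mul hfst.ne' hcond.ne', infoDensity, Real.logb_div hcond.ne' hsnd.ne']
  ring

end ChannelInformation

/-! ### Existence of codes -/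

lemma logb_natCeil_rpow_mem_Icc {x : ℝ} (hx : 0 ≤ x) :
    Real.logb 2 ⌈(2 : ℝ) ^ x⌉₊ ∈ Set.Icc x (x + 1) := by
  have hpow : (1 : ℝ) ≤ 2 ^ x := Real.one_le_rpow one_le_two hx
  have hceil : (0 : ℝ) < ⌈(2 : ℝ) ^ x⌉₊ := by positivity
  rw [Set.mem_Icc, Real.le_logb_iff_rpow_le one_lt_two hceil,
    Real.logb_le_iff_le_rpow one_lt_two hceil, Real.rpow_add two_pos, Real.rpow_one]
  exact ⟨Nat.le_ceil _, by linarith [Nat.ceil_lt_add_one (zero_le_one.trans hpow)]⟩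

lemma sub_one_le_logb_natFloor_rpow {x : ℝ} (hx : 0 ≤ x) :
    x - 1 ≤ Real.logb 2 ⌊(2 : ℝ) ^ x⌋₊ := by
  have hfloor : (1 : ℝ) ≤ ⌊(2 : ℝ) ^ x⌋₊ := by
    exact_mod_cast (Nat.one_le_floor_iff _).2 (Real.one_le_rpow one_le_two hx)
  rw [Real.le_logb_iff_rpow_le one_lt_two (one_pos.trans_le hfloor), Real.rpow_sub_one two_ne_zero]
  linarith [Nat.lt_floor_add_one ((2 : ℝ) ^ x)]

lemma one_le_logb_two_natCast {n : ℕ} (hn : 2 ≤ n) : 1 ≤ Real.logb 2 n := by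
  rw [Real.le_logb_iff_rpow_le one_lt_two (by positivity), Real.rpow_one]
  exact_mod_cast hn

lemma logb_two_natCast_le {n : ℕ} (hn : 1 ≤ n) : Real.logb 2 n ≤ 2 * (n * devScale n) := by
  have hlog := Real.log_two_gt_d9
  have hscale : devScale n ≤ 1 :=
    Real.sqrt_le_one.2 (div_le_one_of_le₀ (Real.log_le_self n.cast_nonneg) n.cast_nonneg)
  rw [Real.logb, ← mul_devScale_sq hn, div_le_iff₀ (by linarith)]
  calc n * devScale n ^ 2 ≤ n * devScale n := by
        gcongr
        exact pow_le_of_le_one (devScale_nonneg n) hscale two_ne_zero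
    _ ≤ n * devScale n * (2 * Real.log 2) :=
        le_mul_of_one_le_right (mul_nonneg n.cast_nonneg (devScale_nonneg n)) (by linarith)
    _ = 2 * (n * devScale n) * Real.log 2 := by ring

lemma exists_natCast_logb_bounds {n : ℕ} (hn : 2 ≤ n) {r R : ℝ} (hr : 0 ≤ r) (hR : 0 ≤ R) :
    ∃ L : ℕ, 1 ≤ L ∧ n * (r - 2 * devScale n) ≤ Real.logb 2 (L / n) ∧
      Real.logb 2 (L * n) ≤ n * (r + 4 * devScale n) ∧
      n * (R + r - 4 * devScale n) ≤ Real.logb 2 (⌊(2 : ℝ) ^ (n * R)⌋₊ * L / n) := by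
  have hL : 0 < ⌈(2 : ℝ) ^ (n * r)⌉₊ := by positivity
  have hM : 0 < ⌊(2 : ℝ) ^ (n * R)⌋₊ :=
    (Nat.one_le_floor_iff _).2 (Real.one_le_rpow one_le_two (by positivity))
  have hn₀ : (n : ℝ) ≠ 0 := by positivity
  have hL₀ : (⌈(2 : ℝ) ^ (n * r)⌉₊ : ℝ) ≠ 0 := by exact_mod_cast hL.ne'
  have hM₀ : (⌊(2 : ℝ) ^ (n * R)⌋₊ : ℝ) ≠ 0 := by exact_mod_cast hM.ne'
  obtain ⟨hLr, hrL⟩ := logb_natCeil_rpow_mem_Icc (show 0 ≤ n * r by positivity)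
  have hMR := sub_one_le_logb_natFloor_rpow (show 0 ≤ n * R by positivity)
  have hlog := logb_two_natCast_le (one_le_two.trans hn)
  have hone := one_le_logb_two_natCast hn
  refine ⟨_, hL, ?_, ?_, ?_⟩
  · rw [Real.logb_div hL₀ hn₀]
    linarith
  · rw [Real.logb_mul hL₀ hn₀]
    linarith
  · rw [Real.logb_div (mul_ne_zero hM₀ hL₀) hn₀, Real.logb_mul hM₀ hL₀]
    linarith

section CodeExistence

variable {W U X Y V : Type*} [Fintype W] [Fintype U] [Fintype X] [Fintype Y] [Fintype V]

namespace TestChannel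

variable (T : TestChannel W U X Y V)

lemma law_joint_fst (w : W) : law (T.joint w) (fun z => z.1) = T.toU w := by
  classical
  funext u
  simp only [law, Fintype.sum_prod_type, joint]
  rw [Finset.sum_eq_single u (fun u' _ h => by simp [h]) (by simp)]
  simp [← Finset.mul_sum, (T.toV_mem _ _).2, (T.toY_mem _).2, (T.toX_mem _ _).2]

lemma law_joint_relay (w : W) : law (T.joint w) (fun z => z.2.2.1) = T.relay w := by
  classical
  funext y
  simp only [law, Fintype.sum_prod_type, joint, relay]
  refine Finset.sum_congr rfl fun u _ => Finset.sum_congr rfl fun x _ => ?_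
  rw [Finset.sum_eq_single y (fun y' _ h => by simp [h]) (by simp)]
  simp [← Finset.mul_sum, (T.toV_mem _ _).2]

lemma channelInfo_toU_nonneg : 0 ≤ channelInfo T.toU T.prior := by
  have h := mutualInfo_jointLaw T.prior_mem T.joint_mem fun z => z.1
  simp only [law_joint_fst] at h
  exact h ▸ mutualInfo_nonneg (jointLaw_mem T.prior_mem T.joint_mem) _ _

/-- The block code whose message-`k` encoder and decoder are the likelihood encoder and decoder of
row `k` of the codebook `c`. -/
def code {n M : ℕ} {κ : Type*} [Fintype κ] [Nonempty κ] (c : Fin M → κ → Fin n → W) :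
    Code U X Y V n M where
  enc u k := (T.pow (Fin n)).encoder (c k) u
  enc_mem u k := (T.pow (Fin n)).encoder_mem (c k) u
  dec y k := (T.pow (Fin n)).decoder (c k) y
  dec_mem y k := (T.pow (Fin n)).decoder_mem (c k) y

lemma l1Dist_code {n M : ℕ} {κ : Type*} [Fintype κ] [Nonempty κ] (c : Fin M → κ → Fin n → W) :
    (T.code c).l1Dist T.source T.toY T.target = (T.pow (Fin n)).codingError c := by
  simp only [codingError, Fintype.sum_prod_type, Code.l1Dist, Code.induced, codedLaw, target_pow,
    source_pow, Fintype.card_fin, ← Finset.mul_sum, div_eq_inv_mul, mul_one]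
  rfl

lemma exists_code_of_density_tails_le {n M L : ℕ} (hn : 1 ≤ n) (hM : 1 ≤ M) (hL : 1 ≤ L)
    (hU : densityUpperTail (powLaw T.prior) (powKernel T.toU : (Fin n → W) → _) (L / n) ≤ 1 / n)
    (hY : densityLowerTail (powLaw T.prior) (powKernel T.relay : (Fin n → W) → _) (L * n) ≤ 1 / n)
    (hJ : densityUpperTail (powLaw T.prior) (powKernel T.joint : (Fin n → W) → _) (M * L / n) ≤
      1 / n) :
    ∃ c : Code U X Y V n M, c.l1Dist T.source T.toY T.target ≤ 10 / √n := by
  have : Nonempty (Fin L) := ⟨⟨0, hL⟩⟩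
  have : Nonempty (Fin M) := ⟨⟨0, hM⟩⟩
  have hn₀ : (0 : ℝ) < n := by exact_mod_cast hn
  have hM₀ : (0 : ℝ) < M := by exact_mod_cast hM
  have hL₀ : (0 : ℝ) < L := by exact_mod_cast hL
  obtain ⟨c, hc⟩ := (T.pow (Fin n)).exists_codingError_le (ι := Fin M) (κ := Fin L)
    (θ₁ := L / n) (θ₂ := L * n) (θ₃ := M * L / n)
    (div_nonneg hL₀.le hn₀.le) (mul_pos hL₀ hn₀) (div_nonneg (mul_nonneg hM₀.le hL₀.le) hn₀.le)
  refine ⟨T.code c, (T.l1Dist_code c).trans_le (hc.trans ?_)⟩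
  rw [densityUpperTail_joint_pow, relay_pow]
  have hratio₁ : (L : ℝ) / n / L = 1 / n := by field_simp
  have hratio₂ : (L : ℝ) / (L * n) = 1 / n := by field_simp
  have hratio₃ : (M : ℝ) * L / n / (M * L) = 1 / n := by field_simp
  have hsqrt : √(1 / (n : ℝ)) = 1 / √n := by rw [Real.sqrt_div zero_le_one, Real.sqrt_one]
  have hle : 1 / (n : ℝ) ≤ 1 / √n :=
    one_div_le_one_div_of_le (Real.sqrt_pos.2 hn₀)
      (Real.sqrt_le_self_iff.2 (.inr (by exact_mod_cast hn)))
  simp only [Fintype.card_fin, Fintype.card_prod, Nat.cast_mul]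
  rw [hratio₁, hratio₂, hratio₃, hsqrt]
  have hten : 10 / √(n : ℝ) = 10 * (1 / √n) := by ring
  change _ + 2 * densityUpperTail (powLaw T.prior) (powKernel T.toU) _ +
    2 * (densityLowerTail (powLaw T.prior) _ _ + _) + _ ≤ _
  linarith

lemma exists_code_l1Dist_le :
    ∃ g : ℝ, 0 < g ∧ ∀ n : ℕ, 1 ≤ n → ∀ R₀ : ℝ, 0 ≤ R₀ →
      channelInfo T.toU T.prior + g * devScale n ≤ channelInfo T.relay T.prior →
      channelInfo T.joint T.prior - channelInfo T.relay T.prior + g * devScale n ≤ R₀ →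
      ∃ c : Code U X Y V n ⌊(2 : ℝ) ^ (n * R₀)⌋₊,
        c.l1Dist T.source T.toY T.target ≤ 10 / √n := by
  obtain ⟨gU, hgU, hU⟩ := exists_densityUpperTail_le T.prior_mem T.toU_mem
  obtain ⟨gY, hgY, hY⟩ := exists_densityLowerTail_le T.prior_mem T.relay_mem
  obtain ⟨gJ, hgJ, hJ⟩ := exists_densityUpperTail_le T.prior_mem T.joint_mem
  refine ⟨gU + gY + gJ + 8, by positivity, fun n hn R₀ hR₀ hUY hJY => ?_⟩
  have hn₀ : (0 : ℝ) < n := by exact_mod_cast hn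
  have hM : 1 ≤ ⌊(2 : ℝ) ^ (n * R₀)⌋₊ :=
    (Nat.one_le_floor_iff _).2 (Real.one_le_rpow one_le_two (by positivity))
  obtain rfl | hn₂ := hn.eq_or_lt
  · refine T.exists_code_of_density_tails_le le_rfl hM le_rfl ?_ ?_ ?_ <;>
      simp only [Nat.cast_one, div_one]
    exacts [prob_jointLaw_powKernel_le_one (ι := Fin 1) T.prior_mem T.toU_mem _,
      prob_jointLaw_powKernel_le_one (ι := Fin 1) T.prior_mem T.relay_mem _,
      prob_jointLaw_powKernel_le_one (ι := Fin 1) T.prior_mem T.joint_mem _]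
  have hδ := devScale_nonneg n
  have hδU := mul_nonneg hgU.le hδ
  have hδJ := mul_nonneg hgJ.le hδ
  have hI := T.channelInfo_toU_nonneg
  obtain ⟨L, hL, hLU, hLY, hLJ⟩ := exists_natCast_logb_bounds hn₂
    (r := channelInfo T.relay T.prior - (gY + 4) * devScale n) (by linarith) hR₀
  have hL₀ : (0 : ℝ) < L := by exact_mod_cast hL
  have hM₀ : (0 : ℝ) < ⌊(2 : ℝ) ^ (n * R₀)⌋₊ := by exact_mod_cast hM
  refine T.exists_code_of_density_tails_le hn hM hL
    (hU n hn _ (div_pos hL₀ hn₀) (le_trans ?_ hLU)) (hY n hn _ (hLY.trans ?_))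
    (hJ n hn _ (div_pos (mul_pos hM₀ hL₀) hn₀) (le_trans ?_ hLJ)) <;>
  · gcongr
    linarith

end TestChannel

end CodeExistence

/-! ### The Gaussian tail at nonpositive arguments -/

lemma integrable_gaussianDensity :
    MeasureTheory.Integrable fun x : ℝ => (1 / √(2 * Real.pi)) * Real.exp (-x ^ 2 / 2) := by
  have h := (integrable_exp_neg_mul_sq (b := 1 / 2) (by norm_num)).const_mul (1 / √(2 * Real.pi))
  refine h.congr (.of_forall fun x => ?_)
  ring_nf

lemma gaussianQ_zero : gaussianQ 0 = 1 / 2 := by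
  have hexp (x : ℝ) : Real.exp (-x ^ 2 / 2) = Real.exp (-(1 / 2) * x ^ 2) := by ring_nf
  have hpi : Real.pi / (1 / 2) = 2 * Real.pi := by ring
  have : 0 < √(2 * Real.pi) := by positivity
  rw [gaussianQ, MeasureTheory.integral_const_mul]
  simp only [hexp, integral_gaussian_Ioi, hpi]
  field_simp

lemma half_lt_gaussianQ {t : ℝ} (ht : t < 0) : 1 / 2 < gaussianQ t := by
  have hint := integrable_gaussianDensity
  have hpos : 0 < ∫ x in Set.Ioc t 0, (1 / √(2 * Real.pi)) * Real.exp (-x ^ 2 / 2) := by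
    rw [← intervalIntegral.integral_of_le ht.le]
    exact intervalIntegral.intervalIntegral_pos_of_pos hint.intervalIntegrable
      (fun x => by positivity) ht
  rw [← gaussianQ_zero, gaussianQ, gaussianQ, ← Set.Ioc_union_Ioi_eq_Ioi ht.le,
    MeasureTheory.setIntegral_union (Set.Ioc_disjoint_Ioi le_rfl) measurableSet_Ioi
      hint.integrableOn hint.integrableOn]
  exact lt_add_of_pos_left _ hpos

lemma gaussianQInv_nonneg {p : ℝ} (hp : p ≤ 1 / 2) : 0 ≤ gaussianQInv p :=
  Real.sInf_nonneg fun _ ht => not_lt.1 fun h => (half_lt_gaussianQ h).not_ge (le_trans ht hp)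

/-! ### Joint distributions that factorize through the auxiliary variable -/

section Outcome

variable {U W X Y V : Type*} [Fintype U] [Fintype W] [Fintype X] [Fintype Y] [Fintype V]

/-- Moves the auxiliary coordinate of an outcome to the front. -/
def auxFirst : Outcome U W X Y V ≃ W × (U × X × Y × V) where
  toFun ω := (ω.2.1, ω.1, ω.2.2)
  invFun t := (t.2.1, t.1, t.2.2)

namespace TestChannel

variable (T : TestChannel W U X Y V)

/-- The joint distribution of `(U, W, X, Y, V)`. -/
def outcomeLaw : Outcome U W X Y V → ℝ := jointLaw T.prior T.joint ∘ auxFirst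

lemma outcomeLaw_mem : T.outcomeLaw ∈ stdSimplex ℝ (Outcome U W X Y V) := by
  have h := jointLaw_mem T.prior_mem T.joint_mem
  exact ⟨fun ω => h.1 (auxFirst ω), (auxFirst.sum_comp _).trans h.2⟩

lemma law_outcomeLaw : law T.outcomeLaw (fun ω => (rvU ω, rvX ω, rvY ω, rvV ω)) = T.target := by
  refine (law_comp_equiv auxFirst (jointLaw T.prior T.joint) fun t => t.2).trans ?_
  rw [law_jointLaw_snd T.prior T.joint fun z => z]
  simp only [law_id]
  rfl

lemma mutualInfo_outcomeLaw {γ : Type*} [Fintype γ] (f : U × X × Y × V → γ) :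
    mutualInfo T.outcomeLaw rvW (fun ω => f (rvU ω, rvX ω, rvY ω, rvV ω)) =
      channelInfo (fun w => law (T.joint w) f) T.prior :=
  (mutualInfo_comp_equiv auxFirst _ Prod.fst fun t => f t.2).trans
    (mutualInfo_jointLaw T.prior_mem T.joint_mem f)

lemma mutualInfo_outcomeLaw_rvU :
    mutualInfo T.outcomeLaw rvW rvU = channelInfo T.toU T.prior := by
  simpa only [law_joint_fst] using T.mutualInfo_outcomeLaw fun z => z.1

lemma mutualInfo_outcomeLaw_rvY :
    mutualInfo T.outcomeLaw rvW rvY = channelInfo T.relay T.prior := by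
  simpa only [law_joint_relay] using T.mutualInfo_outcomeLaw fun z => z.2.2.1

lemma condMutualInfo_outcomeLaw :
    condMutualInfo T.outcomeLaw rvW (fun ω => (rvU ω, rvX ω, rvV ω)) rvY =
      channelInfo T.joint T.prior - channelInfo T.relay T.prior := by
  have hinj : Function.Injective
      fun z : U × X × Y × V => ((z.1, z.2.1, z.2.2.2), z.2.2.1) := by
    rintro ⟨u, x, y, v⟩ ⟨u', x', y', v'⟩ h
    simp_all
  have hsplit := mutualInfo_comp_injective_right hinj T.outcomeLaw rvW
    fun ω => (rvU ω, rvX ω, rvY ω, rvV ω)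
  have hall := T.mutualInfo_outcomeLaw fun z => z
  simp only [law_id] at hall
  rw [eq_sub_iff_add_eq, ← mutualInfo_outcomeLaw_rvY, condMutualInfo_add_mutualInfo]
  exact hsplit.trans hall

lemma exists_achievable :
    ∃ g : ℝ, 0 < g ∧ ∀ n : ℕ, 1 ≤ n → ∀ R₀ : ℝ,
      mutualInfo T.outcomeLaw rvW rvU + g * devScale n ≤ mutualInfo T.outcomeLaw rvW rvY →
      condMutualInfo T.outcomeLaw rvW (fun ω => (rvU ω, rvX ω, rvV ω)) rvY + g * devScale n ≤ R₀ →
      Achievable T.source T.toY n (10 / √n)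
        (law T.outcomeLaw fun ω => (rvU ω, rvX ω, rvY ω, rvV ω)) R₀ := by
  obtain ⟨g, hg, hcode⟩ := T.exists_code_l1Dist_le
  refine ⟨g, hg, fun n hn R₀ hUY hR => ?_⟩
  have hR₀ : 0 ≤ R₀ := (add_nonneg (condMutualInfo_nonneg T.outcomeLaw_mem _ _ _)
    (mul_nonneg hg.le (devScale_nonneg n))).trans hR
  rw [mutualInfo_outcomeLaw_rvU, mutualInfo_outcomeLaw_rvY] at hUY
  rw [condMutualInfo_outcomeLaw] at hR
  refine ⟨law_mem T.outcomeLaw_mem _, hR₀, ?_⟩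
  rw [law_outcomeLaw]
  exact hcode n hn R₀ hR₀ hUY hR

end TestChannel

lemma Factorizes.exists_testChannel {PU : U → ℝ} (hPU : PU ∈ stdSimplex ℝ U) {PYX : X → Y → ℝ}
    (hPYX : ∀ x, PYX x ∈ stdSimplex ℝ Y) {J : Outcome U W X Y V → ℝ} (h : Factorizes PU PYX J) :
    ∃ T : TestChannel W U X Y V, T.source = PU ∧ T.toY = PYX ∧ T.outcomeLaw = J := by
  obtain ⟨PW, PX, PV, hPW, hPX, hPV, hJ⟩ := h
  have hnonneg (u : U) (w : W) : 0 ≤ PU u * PW u w := mul_nonneg (hPU.1 u) ((hPW u).1 w)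
  let p : W → ℝ := outputLaw PW PU
  have hp : p ∈ stdSimplex ℝ W := outputLaw_mem hPU hPW
  -- Where `p w = 0` the posterior of `U` is not determined; the source is used instead.
  let K : W → U → ℝ := fun w u => if p w = 0 then PU u else PU u * PW u w / p w
  have hbayes (w : W) (u : U) : p w * K w u = PU u * PW u w := by
    by_cases hw : p w = 0
    · rw [hw, zero_mul]
      exact ((Finset.sum_eq_zero_iff_of_nonneg fun u _ => hnonneg u w).1 hw u
        (Finset.mem_univ u)).symm
    · simp only [K, hw, if_false]
      exact mul_div_cancel₀ _ hw
  have hK (w : W) : K w ∈ stdSimplex ℝ U := by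
    by_cases hw : p w = 0
    · simpa only [K, hw, if_true] using hPU
    · simp only [K, hw, if_false]
      refine ⟨fun u => div_nonneg (hnonneg u w) (hp.1 w), ?_⟩
      rw [← Finset.sum_div]
      exact div_self hw
  refine ⟨⟨p, hp, K, hK, PX, hPX, PYX, hPYX, PV, hPV⟩, funext fun u => ?_, rfl, funext ?_⟩
  · simp only [TestChannel.source, outputLaw, hbayes, ← Finset.mul_sum, (hPW u).2, mul_one]
  · rintro ⟨u, w, x, y, v⟩
    change p w * (K w u * PX u w x * PYX x y * PV w y v) = _
    rw [hJ, ← hbayes w u]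
    ring

end Outcome

/-! ### The rate conditions of the inner region -/

section InnerBound

variable {U W X Y V : Type*} [Fintype U] [Fintype W] [Fintype X] [Fintype Y] [Fintype V]

lemma const₁_nonneg {J : Outcome U W X Y V → ℝ} (hJ : J ∈ stdSimplex ℝ (Outcome U W X Y V)) :
    0 ≤ const₁ J :=
  add_nonneg (entropy_nonneg hJ _) (entropy_nonneg hJ _)

lemma mutualInfo_le_const₁ {J : Outcome U W X Y V → ℝ}
    (hJ : J ∈ stdSimplex ℝ (Outcome U W X Y V)) : mutualInfo J rvW rvY ≤ const₁ J := by
  have hWY := mutualInfo_le_entropy hJ.1 rvW rvY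
  have hUW := condEntropy_nonneg hJ.1 rvU rvW
  have hU := entropy_nonneg hJ rvU
  rw [condEntropy] at hUW
  rw [const₁]
  linarith

lemma mutualInfo_le_const₃ {J : Outcome U W X Y V → ℝ}
    (hJ : J ∈ stdSimplex ℝ (Outcome U W X Y V)) : mutualInfo J rvW rvY ≤ const₃ J :=
  (mutualInfo_le_entropy hJ.1 rvW rvY).trans (le_add_of_nonneg_left (entropy_nonneg hJ _))

lemma mul_devScale_le {n : ℕ} (hn : 1 ≤ n) {g c ε : ℝ} (hc : 0 < c) (hε : 0 ≤ ε)
    (h : (g / c) ^ 2 * Real.log n ≤ n * ε ^ 2) : g * devScale n ≤ c * ε := by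
  have hsq : (g / c * devScale n) ^ 2 ≤ ε ^ 2 := by
    refine le_of_mul_le_mul_left ?_ (Nat.cast_pos.2 hn : (0 : ℝ) < n)
    calc n * (g / c * devScale n) ^ 2 = (g / c) ^ 2 * (n * devScale n ^ 2) := by ring
      _ ≤ n * ε ^ 2 := by rwa [mul_devScale_sq hn]
  calc g * devScale n = c * (g / c * devScale n) := by field_simp
    _ ≤ c * ε := mul_le_mul_of_nonneg_left (abs_le_of_sq_le_sq' hsq hε).2 hc.le

/-- The coefficient of `log n / n` in the rate conditions. Below the threshold
`n * ε ^ 2 ≥ A * log n` it is so large that its term is at least `G`, which makes the first rate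
condition void if `G` exceeds the mutual information it allows. -/
def coefficient (A G ε : ℝ) (n : ℕ) : ℝ := if A * Real.log n ≤ n * ε ^ 2 then 3 / 2 else n * G

lemma coefficient_nonneg (A : ℝ) {G : ℝ} (hG : 0 ≤ G) (ε : ℝ) (n : ℕ) :
    0 ≤ coefficient A G ε n := by
  rw [coefficient]
  split_ifs <;> positivity

lemma eventually_mul_log_le (A : ℝ) {ε : ℝ} (hε : 0 < ε) :
    ∀ᶠ n : ℕ in Filter.atTop, A * Real.log n ≤ n * ε ^ 2 := by
  have hlog := (Real.isLittleO_log_id_atTop.const_mul_left A).bound (pow_pos hε 2)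
  filter_upwards [tendsto_natCast_atTop_atTop.eventually hlog] with n hn
  rw [id, Real.norm_natCast, mul_comm (ε ^ 2)] at hn
  exact (le_abs_self _).trans hn

lemma exists_coefficient_le (A : ℝ) {G : ℝ} (hG : 0 ≤ G) {ε : ℝ} (hε : 0 < ε) :
    ∃ C, ∀ n, coefficient A G ε n ≤ C := by
  obtain ⟨N, hN⟩ := Filter.eventually_atTop.1 (eventually_mul_log_le A hε)
  refine ⟨max (3 / 2) (N * G), fun n => ?_⟩
  rw [coefficient]
  split_ifs with h
  · exact le_max_left _ _
  · have hn : n ≤ N := le_of_not_ge fun hNn => h (hN n hNn)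
    exact le_max_of_le_right (by gcongr)

lemma le_coefficient_mul {A G ε : ℝ} (hG : 0 ≤ G) {n : ℕ} (hn : 1 ≤ n)
    (h : ¬A * Real.log n ≤ n * ε ^ 2) : G ≤ coefficient A G ε n * (Real.logb 2 n / n) := by
  have hn₂ : 2 ≤ n := by
    refine lt_of_le_of_ne hn fun hn₁ => h ?_
    rw [← hn₁, Nat.cast_one, Real.log_one, mul_zero]
    positivity
  calc G ≤ G * Real.logb 2 n := le_mul_of_one_le_right hG (one_le_logb_two_natCast hn₂)
    _ = coefficient A G ε n * (Real.logb 2 n / n) := by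
      rw [coefficient, if_neg h]
      field_simp

lemma exists_mul_devScale_le_const {J : Outcome U W X Y V → ℝ}
    (hJ : J ∈ stdSimplex ℝ (Outcome U W X Y V)) {g : ℝ} (hg : 0 < g) :
    ∃ A > 0, ∀ n : ℕ, 1 ≤ n → ∀ ε > 0, A * Real.log n ≤ n * ε ^ 2 →
      (2 ≤ n → 0 < mutualInfo J rvW rvY) →
      g * devScale n ≤ const₁ J * ε ∧ g * devScale n ≤ const₃ J * ε := by
  by_cases hI : 0 < mutualInfo J rvW rvY
  · have hc : 0 < min (const₁ J) (const₃ J) :=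
      hI.trans_le (le_min (mutualInfo_le_const₁ hJ) (mutualInfo_le_const₃ hJ))
    refine ⟨(g / min (const₁ J) (const₃ J)) ^ 2, by positivity, fun n hn ε hε h _ => ?_⟩
    have hdev := mul_devScale_le hn hc hε.le h
    exact ⟨hdev.trans (by gcongr; exact min_le_left _ _),
      hdev.trans (by gcongr; exact min_le_right _ _)⟩
  · refine ⟨1, one_pos, fun n hn ε hε _ hI' => ?_⟩
    obtain rfl : n = 1 := le_antisymm (not_lt.1 fun hn₂ => hI (hI' hn₂)) hn
    have hc₃ : 0 ≤ const₃ J := add_nonneg (entropy_nonneg hJ _) (entropy_nonneg hJ _)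
    have hdev : devScale 1 = 0 := by simp [devScale]
    rw [hdev, mul_zero]
    exact ⟨mul_nonneg (const₁_nonneg hJ) hε.le, mul_nonneg hc₃ hε.le⟩

lemma TestChannel.exists_coefficient_achievable (T : TestChannel W U X Y V) :
    ∃ A > 0, ∃ G ≥ 0, ∀ n : ℕ, 1 ≤ n → ∀ ε > 0, ∀ D ≥ 0, ∀ R₀ : ℝ,
      mutualInfo T.outcomeLaw rvW rvU ≤ mutualInfo T.outcomeLaw rvW rvY -
        (const₁ T.outcomeLaw * ε + coefficient A G ε n * (Real.logb 2 n / n) + D) →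
      condMutualInfo T.outcomeLaw rvW (fun ω => (rvU ω, rvX ω, rvV ω)) rvY +
        (const₃ T.outcomeLaw * ε + coefficient A G ε n * (Real.logb 2 n / n) + D) ≤ R₀ →
      Achievable T.source T.toY n (10 / √n)
        (law T.outcomeLaw fun ω => (rvU ω, rvX ω, rvY ω, rvV ω)) R₀ := by
  have hT := T.outcomeLaw_mem
  obtain ⟨g, hg, hach⟩ := T.exists_achievable
  obtain ⟨A, hA, hdev⟩ := exists_mul_devScale_le_const hT hg
  have hWU := mutualInfo_nonneg hT rvW rvU
  have hG : 0 ≤ 1 + mutualInfo T.outcomeLaw rvW rvY :=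
    add_nonneg zero_le_one (mutualInfo_nonneg hT rvW rvY)
  refine ⟨A, hA, _, hG, fun n hn ε hε D hD R₀ hUY hR => ?_⟩
  have hc₁ := mul_nonneg (const₁_nonneg hT) hε.le
  by_cases h : A * Real.log n ≤ n * ε ^ 2
  · rw [coefficient, if_pos h] at hUY hR
    have hlog : 0 ≤ Real.logb 2 n / n :=
      div_nonneg (Real.logb_nonneg one_lt_two (by exact_mod_cast hn)) n.cast_nonneg
    have hpos (hn₂ : 2 ≤ n) : 0 < mutualInfo T.outcomeLaw rvW rvY := by
      have hlog' : 0 < Real.logb 2 n / n :=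
        div_pos (one_pos.trans_le (one_le_logb_two_natCast hn₂)) (by positivity)
      linarith
    obtain ⟨hdev₁, hdev₃⟩ := hdev n hn ε hε h hpos
    exact hach n hn R₀ (by linarith) (by linarith)
  · have hvoid := le_coefficient_mul hG hn h
    linarith

/-- `Factorizes` comes after the quantifiers so that `A` and `G` can be chosen for every `J`. -/
lemma exists_coefficient_achievable {PU : U → ℝ} (hPU : PU ∈ stdSimplex ℝ U) {PYX : X → Y → ℝ}
    (hPYX : ∀ x, PYX x ∈ stdSimplex ℝ Y) (J : Outcome U W X Y V → ℝ) :
    ∃ A > 0, ∃ G ≥ 0, Factorizes PU PYX J →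
      ∀ n : ℕ, 1 ≤ n → ∀ ε > 0, ∀ D ≥ 0, ∀ R₀ : ℝ,
      mutualInfo J rvW rvU ≤ mutualInfo J rvW rvY -
        (const₁ J * ε + coefficient A G ε n * (Real.logb 2 n / n) + D) →
      condMutualInfo J rvW (fun ω => (rvU ω, rvX ω, rvV ω)) rvY +
        (const₃ J * ε + coefficient A G ε n * (Real.logb 2 n / n) + D) ≤ R₀ →
      Achievable PU PYX n (10 / √n) (law J fun ω => (rvU ω, rvX ω, rvY ω, rvV ω)) R₀ := by
  by_cases hJ : Factorizes PU PYX J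
  · obtain ⟨T, rfl, rfl, rfl⟩ := hJ.exists_testChannel hPU hPYX
    obtain ⟨A, hA, G, hG, hach⟩ := T.exists_coefficient_achievable
    exact ⟨A, hA, G, hG, fun _ => hach⟩
  · exact ⟨1, one_pos, 0, le_rfl, fun h => absurd h hJ⟩

end InnerBound

lemma coordinationRegion_mono {U X Y V : Type*} [Fintype U] [Fintype X] [Fintype Y] [Fintype V]
    (PU : U → ℝ) (PYX : X → Y → ℝ) (n : ℕ) {ε ε' : ℝ} (h : ε ≤ ε') :
    (coordinationRegion PU PYX n ε : Set ((U × X × Y × V → ℝ) × ℝ)) ⊆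
      coordinationRegion PU PYX n ε' :=
  closure_mono fun _ hp => ⟨hp.1, hp.2.1, hp.2.2.imp fun _ hc => hc.trans h⟩

end

end StrongCoord

open StrongCoord in
theorem mainTheorem1_general {U W X Y V : Type*}
    [Fintype U] [Fintype W] [Fintype X] [Fintype Y] [Fintype V]
    (PU : U → ℝ) (hPU : PU ∈ stdSimplex ℝ U)
    (PYX : X → Y → ℝ) (hPYX : ∀ x, PYX x ∈ stdSimplex ℝ Y) :
    ∃ κ : (Outcome U W X Y V → ℝ) → ℝ → ℕ → ℝ,
      (∀ J, ∀ ε₁ > 0, ∃ C : ℝ, ∀ n : ℕ, 1 ≤ n → 0 ≤ κ J ε₁ n ∧ κ J ε₁ n ≤ C) ∧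
      (∀ J, ∃ A > 0, ∀ ε₁ > 0, ∀ n : ℕ, 1 ≤ n →
        A * Real.log n ≤ n * ε₁ ^ 2 → κ J ε₁ n = 3 / 2) ∧
      ∀ (B : (Outcome U W X Y V → ℝ) → ℝ) (n : ℕ), 1 ≤ n → ∀ ε₁ > 0, ∀ ε₅ : ℝ,
        innerRegion PU PYX n ε₁ ε₅ (fun J => κ J ε₁ n) B ⊆
          coordinationRegion PU PYX n (10 / √n) := by
  choose A hA G hG hach using exists_coefficient_achievable (W := W) (V := V) hPU hPYX
  refine ⟨fun J => coefficient (A J) (G J), fun J ε₁ hε₁ => ?_, fun J => ?_, ?_⟩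
  · obtain ⟨C, hC⟩ := exists_coefficient_le (A J) (hG J) hε₁
    exact ⟨C, fun n _ => ⟨coefficient_nonneg _ (hG J) _ _, hC n⟩⟩
  · exact ⟨A J, hA J, fun ε₁ _ n _ h => if_pos h⟩
  · rintro B n hn ε₁ hε₁ ε₅ ⟨P, R₀⟩ ⟨J, hJ, rfl, -, hε₄, hUY, hR⟩
    exact subset_closure (hach J hJ n hn ε₁ hε₁ _
      (mul_nonneg (gaussianQInv_nonneg hε₄) (Real.sqrt_nonneg _)) R₀ hUY hR)

theorem mainTheorem1 {U W X Y V : Type*}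
    [Fintype U] [Fintype W] [Fintype X] [Fintype Y] [Fintype V]
    (PU : U → ℝ) (hPU : PU ∈ stdSimplex ℝ U)
    (PYX : X → Y → ℝ) (hPYX : ∀ x, PYX x ∈ stdSimplex ℝ Y)
    (B : (StrongCoord.Outcome U W X Y V → ℝ) → ℝ) (hB : ∀ J, 0 ≤ B J) :
    ∃ κ : (StrongCoord.Outcome U W X Y V → ℝ) → ℝ → ℕ → ℝ,
      (∀ J, ∀ ε₁ > 0, ∃ C : ℝ, ∀ n : ℕ, 1 ≤ n → 0 ≤ κ J ε₁ n ∧ κ J ε₁ n ≤ C) ∧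
      (∀ J, ∃ A > 0, ∀ ε₁ > 0, ∀ n : ℕ, 1 ≤ n →
        A * Real.log n ≤ n * ε₁ ^ 2 → κ J ε₁ n = 3 / 2) ∧
      ∀ n : ℕ, 1 ≤ n → ∀ ε₁ > 0, ∀ ε₅ ≥ 0,
        StrongCoord.innerRegion PU PYX n ε₁ ε₅ (fun J => κ J ε₁ n) B ⊆
          StrongCoord.coordinationRegion PU PYX n
            (10 * ε₅ + (10 + 2 * Real.sqrt 2) / Real.sqrt n) := by
  obtain ⟨κ, hbdd, hthr, hsub⟩ := mainTheorem1_general (W := W) (V := V) PU hPU PYX hPYX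
  refine ⟨κ, hbdd, hthr, fun n hn ε₁ hε₁ ε₅ hε₅ => (hsub B n hn ε₁ hε₁ ε₅).trans ?_⟩
  refine StrongCoord.coordinationRegion_mono PU PYX n (le_add_of_nonneg_of_le (by positivity) ?_)
  gcongr
  exact le_add_of_nonneg_right (by positivity)
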